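/- **Setting.** Let $\nu\ge 1$ and let $g$ be a complex random variable with $|g|\le\nu$ almost surely, $\mathbb E g=0$ and $\mathbb E|g|^2=1$. Let $n,L\ge 1$ and let $\boldsymbol D_g=[\boldsymbol d_1,\dots,\boldsymbol d_L]\in\mathbb C^{n\times L}$ be a random matrix (its columns are the masks) whose $nL$ entries are independent copies of $g$. Let $\boldsymbol F$ be the $n\times n$ discrete Fourier matrix, $F_{jk}=e^{-2\pi \mathrm i (j-1)(k-1)/n}$, put $\widehat{\boldsymbol h}=\boldsymbol F\boldsymbol h$ for $\boldsymbol h\in\mathbb C^n$, and let $$\mathcal A(\boldsymbol X)=\tfrac1{\sqrt L}(\boldsymbol F\odot\boldsymbol X)\boldsymbol D_g,\qquad \mathcal A:\mathbb C^{n\times n}\to\mathbb C^{n\times L},$$ where $\odot$ is the entrywise product. Put $\mu=\|\widehat{\boldsymbol h}\|_\infty^2/\|\boldsymbol h\|_2^2$. For $\boldsymbol x\in\mathbb C^n$ and a noise matrix $\widehat{\boldsymbol Z}\in\mathbb C^{n\times L}$ put $\widehat{\boldsymbol Y}=\mathcal A(\widehat{\boldsymbol h}\boldsymbol x^T)+\widehat{\boldsymbol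 Z}$ and consider the constrained least-squares problem $$\min_{\boldsymbol X\in\mathbb C^{n\times n}}\ \|\widehat{\boldsymbol Y}-\mathcal A(\boldsymbol X)\|_F\quad\text{subject to}\quad \|\boldsymbol X\|_*\le \|\widehat{\boldsymbol h}\boldsymbol x^T\|_*,\tag{1}$$ where $\|\cdot\|_F$ is the Frobenius norm and $\|\cdot\|_*$ the nuclear norm. **Theorem 2.** Let $\nu\ge1$, let $C_\nu>0$ be a constant depending on $\nu$, and let $c_1,c_2>0$ be absolute constants. There is a constant $\widetilde C_\nu>0$, depending only on $\nu$ (and on the choice of $C_\nu,c_1,c_2$), such that the following holds for all $n,L\ge 1$ and all $g$, $\boldsymbol D_g$ as above. If $n\ge 32\nu^6L\log n$, then for every unit vector $\boldsymbol x\in\mathbb C^n$ outside a set of surface measure zero on the unit sphere and for every $\boldsymbol h\in\mathbb C^n$ with $\|\widehat{\boldsymbol h}\|_2=1$ and $$c_1\,C_\nu\,\mu\log^2 n\,\log(n/\mu)\,\log\log n\ \le\ L\ \le\ c_2\,C_\nu\,\mu\log^2 n\,\log(n/\mu)\,\log\log n ,$$ with probability at least $1-\frac4n$ there are a noise matrix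 $\widehat{\boldsymbol Z}\neq 0$ and an optimal solution $\boldsymbol X^{\#}$ of the corresponding problem (1) with $$\|\boldsymbol X^{\#}-\widehat{\boldsymbol h}\boldsymbol x^T\|_F\ \ge\ \frac{\sqrt n}{\widetilde C_\nu\,\mu^{1/2}\log^3 n}\,\|\widehat{\boldsymbol Z}\|_F .$$ -/

import Mathlib

open MeasureTheory ProbabilityTheory
open scoped Matrix Matrix.Norms.Frobenius

noncomputable section

namespace BlindDeconv

/-- A mask variable with parameter `ν`: `|g| ≤ ν` almost surely, `𝔼 g = 0`, `𝔼 |g|² = 1`. -/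
structure IsMaskVariable {Ω : Type*} [MeasurableSpace Ω] (P : Measure Ω) (g : Ω → ℂ) (ν : ℝ) :
    Prop where
  aemeasurable : AEMeasurable g P
  norm_le : ∀ᵐ ω ∂P, ‖g ω‖ ≤ ν
  mean_zero : ∫ ω, g ω ∂P = 0
  second_moment : ∫ ω, ‖g ω‖ ^ 2 ∂P = 1

/-- The (unnormalised) `n × n` DFT matrix, with rows and columns numbered from `0`. -/
def dftMatrix (n : ℕ) : Matrix (Fin n) (Fin n) ℂ :=
  Matrix.of fun j k => Complex.exp (-(2 * Real.pi * Complex.I * (j : ℕ) * (k : ℕ)) / n)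

/-- The discrete Fourier transform `ĥ = F h`. -/
def dft {n : ℕ} (h : EuclideanSpace ℂ (Fin n)) : EuclideanSpace ℂ (Fin n) :=
  WithLp.toLp 2 (dftMatrix n *ᵥ h.ofLp)

/-- The coherence `μ = ‖ĥ‖_∞² / ‖h‖₂²` (the norm of `Fin n → ℂ` is the sup norm). -/
def coherence {n : ℕ} (h : EuclideanSpace ℂ (Fin n)) : ℝ :=
  ‖(dft h).ofLp‖ ^ 2 / ‖h‖ ^ 2

/-- The rank-one matrix `u xᵀ` (no complex conjugation). -/
def outer {n : ℕ} (u x : EuclideanSpace ℂ (Fin n)) : Matrix (Fin n) (Fin n) ℂ :=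
  Matrix.vecMulVec u.ofLp x.ofLp

/-- The nuclear norm: the sum of the singular values. -/
def nuclearNorm {m n : ℕ} (X : Matrix (Fin m) (Fin n) ℂ) : ℝ :=
  ∑ i : Fin n, (Matrix.toEuclideanLin X).singularValues i

/-- The measurement operator `𝒜(X) = L^{-1/2} (F ⊙ X) D`; column `l` of `D` is the `l`-th mask. -/
def measurement {n L : ℕ} (D : Matrix (Fin n) (Fin L) ℂ) (X : Matrix (Fin n) (Fin n) ℂ) :
    Matrix (Fin n) (Fin L) ℂ :=
  ((1 / Real.sqrt L : ℝ) : ℂ) • ((dftMatrix n ⊙ X) * D)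

/-- `X` is an optimal solution of `min ‖Y - 𝒜(X)‖_F` subject to `‖X‖_* ≤ R`. -/
def IsConstrainedLSSolution {n L : ℕ} (D : Matrix (Fin n) (Fin L) ℂ)
    (Y : Matrix (Fin n) (Fin L) ℂ) (R : ℝ) (X : Matrix (Fin n) (Fin n) ℂ) : Prop :=
  nuclearNorm X ≤ R ∧
    ∀ X' : Matrix (Fin n) (Fin n) ℂ, nuclearNorm X' ≤ R →
      ‖Y - measurement D X‖ ≤ ‖Y - measurement D X'‖

end BlindDeconv

end

/-!
Write `u = ĥ` and `X₀ = u xᵀ`.  Row `j` of `𝒜(X)` only depends on row `j` of `X`, and this makes a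
direction of descent of the nuclear norm at `X₀` on which `𝒜` is tiny.  Take a single row `j`, and
let `q` be the shortest vector such that `e_j qᵀ` has the same measurements as `e_j xᵀ`.  Since `L`
is much smaller than `n`, `q` is short: `‖q‖² = O(ν² L / n)` for the best `j`.  With `β` of the same
order as `‖q‖` and larger than `|u_j| + ‖q‖`, put `W = e_j (x - q)ᵀ - β X₀`.

* `W` is a direction of descent.  The matrix
  `X₀ + t W = ((1 - t β) u + t e_j) xᵀ - t e_j qᵀ` has rank two, its nuclear norm is at most
  `‖(1 - t β) u + t e_j‖ + t ‖q‖`, and this is at most `1` for small `t > 0`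
  (`nuclearNorm_descent_le`).
* `‖W‖` is bounded below, while `𝒜(W) = -β 𝒜(X₀)` has norm `O(√(L / n) ‖𝒜(X₀)‖)`.

With the noise `Z = t 𝒜(W)` the matrix `X₀ + t W` is feasible and fits the data exactly, so it is
optimal (`exists_noise_solution`).  If `𝒜(X₀)` happens to vanish, a tiny change of `q` makes `Z`
non-zero (`exists_perturbation`); the argument therefore works for every unit vector `x`.

The existence of a good row (`exists_row_correction`) is Parseval's identity for the DFT, applied to
the orthogonal projections of the vectors `F_j ⊙ x` onto the range of the conjugated mask matrix.
It only needs that all singular values of the mask matrix are at least `√n / 4`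
(`IsMaskFamily.measureReal_exists_norm_lt_le`).  This holds with probability `1 - 1/n`, by a Chernoff
bound for the lower tail of `‖D z‖²` for fixed `z`, whose only input is the fourth moment
`𝔼 |∑ a_l g_l|⁴ ≤ 3 ν² (∑ |a_l|²)²`, and by a union bound over a grid; the hypothesis
`n ≥ 32 ν⁶ L log n` is what pays for the size of the grid.  The bound `‖𝒜(X₀)‖ = O(ν √(log n))`
comes from Hoeffding's inequality (`IsMaskFamily.measureReal_exists_lt_norm_sum_le`).
Finally `L = O(μ log⁴ n)` turns `√(L / n) √(log n)` into `O(√(μ / n) log³ n)`.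
-/

namespace BlindDeconv

/-! ### Moments of linear combinations of masks -/

/-- A family of independent masks with parameter `ν`.  Unlike in `IsMaskVariable`, they are measurable
and the bound `|ξ_i| ≤ ν` holds everywhere, so that all integrability questions are trivial; see
`exists_isMaskFamily_ae_eq` for the passage from almost sure bounds. -/
structure IsMaskFamily {ι Ω : Type*} [MeasurableSpace Ω] (P : Measure Ω) (ξ : ι → Ω → ℂ) (ν : ℝ) :
    Prop where
  indep : iIndepFun ξ P
  meas : ∀ i, Measurable (ξ i)
  norm_le : ∀ i ω, ‖ξ i ω‖ ≤ ν
  mean_zero : ∀ i, ∫ ω, ξ i ω ∂P = 0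
  second_moment : ∀ i, ∫ ω, ‖ξ i ω‖ ^ 2 ∂P = 1

section Probability

variable {Ω : Type*} [MeasurableSpace Ω] {P : Measure Ω}

namespace IsMaskFamily

variable {ι : Type*} {ξ : ι → Ω → ℂ} {ν : ℝ}

lemma precomp (hξ : IsMaskFamily P ξ ν) {κ : Type*} {f : κ → ι} (hf : f.Injective) :
    IsMaskFamily P (fun k => ξ (f k)) ν where
  indep := hξ.indep.precomp hf
  meas _ := hξ.meas _
  norm_le _ := hξ.norm_le _
  mean_zero _ := hξ.mean_zero _
  second_moment _ := hξ.second_moment _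

lemma measurable_sum (hξ : IsMaskFamily P ξ ν) (a : ι → ℂ) (s : Finset ι) :
    Measurable (fun ω => ∑ i ∈ s, a i * ξ i ω) :=
  Finset.measurable_sum _ fun i _ => (hξ.meas i).const_mul _

lemma norm_sum_le (hξ : IsMaskFamily P ξ ν) (a : ι → ℂ) (s : Finset ι) (ω : Ω) :
    ‖∑ i ∈ s, a i * ξ i ω‖ ≤ ∑ i ∈ s, ‖a i‖ * ν := by
  refine (_root_.norm_sum_le _ _).trans (Finset.sum_le_sum fun i _ => ?_)
  rw [norm_mul]
  exact mul_le_mul_of_nonneg_left (hξ.norm_le i ω) (norm_nonneg _)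

lemma indepFun_sum (hξ : IsMaskFamily P ξ ν) (a : ι → ℂ) {s : Finset ι} {i : ι} (hi : i ∉ s) :
    IndepFun (fun ω => ∑ j ∈ s, a j * ξ j ω) (fun ω => a i * ξ i ω) P := by
  have h := hξ.indep.comp (fun j z => a j * z) (fun j => measurable_const_mul _)
  have := h.indepFun_finsetSum_of_notMem (fun j => (hξ.meas j).const_mul _) hi
  convert! this using 1
  ext ω
  simp

end IsMaskFamily

variable [IsProbabilityMeasure P]

lemma integrable_of_measurable_of_norm_le {E : Type*} [NormedAddCommGroup E] [MeasurableSpace E]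
    [BorelSpace E] [SecondCountableTopology E] {f : Ω → E} (hf : Measurable f) {C : ℝ}
    (hC : ∀ ω, ‖f ω‖ ≤ C) : Integrable f P :=
  Integrable.of_bound hf.aestronglyMeasurable C (Filter.Eventually.of_forall hC)

lemma integral_re_mul_eq_zero {S X : Ω → ℂ} (hS : Measurable S) (hX : Measurable X)
    (hind : IndepFun S X P) (h0 : (∫ ω, S ω ∂P) = 0 ∨ (∫ ω, X ω ∂P) = 0)
    {C : ℝ} (hSC : ∀ ω, ‖S ω‖ ≤ C) {C' : ℝ} (hXC : ∀ ω, ‖X ω‖ ≤ C') :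
    ∫ ω, (S ω * X ω).re ∂P = 0 := by
  have h1 : Integrable (fun ω => S ω * X ω) P := by
    refine integrable_of_measurable_of_norm_le (hS.mul hX) (C := C * C') fun ω => ?_
    rw [norm_mul]
    exact mul_le_mul (hSC ω) (hXC ω) (norm_nonneg _) ((norm_nonneg _).trans (hSC ω))
  have h2 := integral_re (𝕜 := ℂ) h1
  have h3 : ∫ ω, S ω * X ω ∂P = 0 := by
    have := hind.integral_fun_mul_eq_mul_integral hS.aestronglyMeasurable hX.aestronglyMeasurable
    rw [this]
    rcases h0 with h | h <;> simp [h]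
  simpa [h3] using h2

lemma norm_add_sq_complex (s x : ℂ) :
    ‖s + x‖ ^ 2 = ‖s‖ ^ 2 + 2 * ((starRingEnd ℂ) s * x).re + ‖x‖ ^ 2 := by
  rw [← Complex.normSq_eq_norm_sq, ← Complex.normSq_eq_norm_sq, ← Complex.normSq_eq_norm_sq]
  simp [Complex.normSq_apply]
  ring

/-- The terms that are odd in `s` or in `x`, which vanish in expectation, are kept exactly; the
square of the mixed term is bounded by Cauchy-Schwarz. -/
lemma norm_add_pow_four_le (s x : ℂ) :
    ‖s + x‖ ^ 4 ≤ ‖s‖ ^ 4 + 6 * (‖s‖ ^ 2 * ‖x‖ ^ 2) + ‖x‖ ^ 4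
      + 4 * ((starRingEnd ℂ) s * (‖s‖ ^ 2 : ℝ) * x).re
      + 4 * ((starRingEnd ℂ) s * (x * (‖x‖ ^ 2 : ℝ))).re := by
  have h := norm_add_sq_complex s x
  set r := ((starRingEnd ℂ) s * x).re with hr
  have h1 : ((starRingEnd ℂ) s * (‖s‖ ^ 2 : ℝ) * x).re = ‖s‖ ^ 2 * r := by
    rw [hr, ← Complex.re_ofReal_mul]; congr 1; ring
  have h2 : ((starRingEnd ℂ) s * (x * (‖x‖ ^ 2 : ℝ))).re = ‖x‖ ^ 2 * r := by
    rw [hr, ← Complex.re_ofReal_mul]; congr 1; ring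
  have h3 : r ^ 2 ≤ ‖s‖ ^ 2 * ‖x‖ ^ 2 := by
    have : |r| ≤ ‖s‖ * ‖x‖ := by
      refine (Complex.abs_re_le_norm _).trans ?_
      simp
    rw [← mul_pow, ← sq_abs]
    exact pow_le_pow_left₀ (abs_nonneg _) this 2
  rw [h1, h2]
  have h4 : ‖s + x‖ ^ 4 = (‖s + x‖ ^ 2) ^ 2 := by ring
  rw [h4, h]
  nlinarith

lemma integral_norm_add_sq {S X : Ω → ℂ} (hS : Measurable S) (hX : Measurable X)
    (hind : IndepFun S X P) (hX0 : ∫ ω, X ω ∂P = 0)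
    {C : ℝ} (hSC : ∀ ω, ‖S ω‖ ≤ C) {C' : ℝ} (hXC : ∀ ω, ‖X ω‖ ≤ C') :
    ∫ ω, ‖S ω + X ω‖ ^ 2 ∂P = ∫ ω, ‖S ω‖ ^ 2 ∂P + ∫ ω, ‖X ω‖ ^ 2 ∂P := by
  have hm : Measurable (starRingEnd ℂ : ℂ → ℂ) := Complex.continuous_conj.measurable
  have h0 := integral_re_mul_eq_zero (hm.comp hS) hX (hind.comp hm measurable_id) (Or.inr hX0)
    (C := C) (fun ω => by simpa using hSC ω) hXC
  have i1 : Integrable (fun ω => ‖S ω‖ ^ 2) P :=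
    integrable_of_measurable_of_norm_le (by fun_prop) (C := C ^ 2) fun ω => by
      simpa using pow_le_pow_left₀ (norm_nonneg _) (hSC ω) 2
  have i2 : Integrable (fun ω => ‖X ω‖ ^ 2) P :=
    integrable_of_measurable_of_norm_le (by fun_prop) (C := C' ^ 2) fun ω => by
      simpa using pow_le_pow_left₀ (norm_nonneg _) (hXC ω) 2
  have i3 : Integrable (fun ω => 2 * ((starRingEnd ℂ) (S ω) * X ω).re) P := by
    refine integrable_of_measurable_of_norm_le (C := 2 * (C * C')) ?_ fun ω => ?_
    · exact (Complex.measurable_re.comp ((hm.comp hS).mul hX)).const_mul 2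
    · rw [norm_mul, Real.norm_eq_abs, Real.norm_eq_abs, abs_two]
      gcongr
      refine (Complex.abs_re_le_norm _).trans ?_
      rw [norm_mul, Complex.norm_conj]
      exact mul_le_mul (hSC ω) (hXC ω) (norm_nonneg _) ((norm_nonneg _).trans (hSC ω))
  simp_rw [norm_add_sq_complex]
  have i13 : Integrable (fun ω => ‖S ω‖ ^ 2 + 2 * ((starRingEnd ℂ) (S ω) * X ω).re) P := i1.add i3
  rw [integral_add i13 i2, integral_add i1 i3, integral_const_mul]
  simp only [Function.comp_apply] at h0
  rw [h0]; simp

lemma integral_norm_add_pow_four_le {S X : Ω → ℂ} (hS : Measurable S) (hX : Measurable X)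
    (hind : IndepFun S X P) (hS0 : ∫ ω, S ω ∂P = 0) (hX0 : ∫ ω, X ω ∂P = 0)
    {C : ℝ} (hSC : ∀ ω, ‖S ω‖ ≤ C) {C' : ℝ} (hXC : ∀ ω, ‖X ω‖ ≤ C') :
    ∫ ω, ‖S ω + X ω‖ ^ 4 ∂P ≤ ∫ ω, ‖S ω‖ ^ 4 ∂P
      + 6 * ((∫ ω, ‖S ω‖ ^ 2 ∂P) * ∫ ω, ‖X ω‖ ^ 2 ∂P) + ∫ ω, ‖X ω‖ ^ 4 ∂P := by
  have hm : Measurable (starRingEnd ℂ : ℂ → ℂ) := Complex.continuous_conj.measurable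
  have hm1 : Measurable (fun z : ℂ => (starRingEnd ℂ) z * (‖z‖ ^ 2 : ℝ)) :=
    (Continuous.mul Complex.continuous_conj (by fun_prop)).measurable
  have hm2 : Measurable (fun z : ℂ => z * (‖z‖ ^ 2 : ℝ)) :=
    (Continuous.mul continuous_id (by fun_prop)).measurable
  have hcs : ∫ ω, (starRingEnd ℂ) (S ω) ∂P = 0 := by rw [integral_conj, hS0, map_zero]
  have h1 := integral_re_mul_eq_zero (hm1.comp hS) hX (hind.comp hm1 measurable_id) (Or.inr hX0)
    (C := C ^ 3) (fun ω => by
      have := pow_le_pow_left₀ (norm_nonneg _) (hSC ω) 3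
      simp only [Function.comp_apply, norm_mul, Complex.norm_conj, Complex.norm_real, norm_pow,
        norm_norm]
      linarith [show ‖S ω‖ * ‖S ω‖ ^ 2 = ‖S ω‖ ^ 3 by ring]) hXC
  have h2 := integral_re_mul_eq_zero (hm.comp hS) (hm2.comp hX) (hind.comp hm hm2) (Or.inl hcs)
    (C := C) (fun ω => by simpa using hSC ω) (C' := C' ^ 3) (fun ω => by
      have := pow_le_pow_left₀ (norm_nonneg _) (hXC ω) 3
      simp only [Function.comp_apply, norm_mul, Complex.norm_real, norm_pow, norm_norm]
      linarith [show ‖X ω‖ * ‖X ω‖ ^ 2 = ‖X ω‖ ^ 3 by ring])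
  have hpow : ∀ (Y : Ω → ℂ) (B : ℝ) (k : ℕ), Measurable Y → (∀ ω, ‖Y ω‖ ≤ B) →
      Integrable (fun ω => ‖Y ω‖ ^ k) P := fun Y B k hY hB =>
    integrable_of_measurable_of_norm_le (by fun_prop) (C := B ^ k) fun ω => by
      simpa using pow_le_pow_left₀ (norm_nonneg _) (hB ω) k
  have j3 : ∫ ω, ‖S ω‖ ^ 2 * ‖X ω‖ ^ 2 ∂P = (∫ ω, ‖S ω‖ ^ 2 ∂P) * ∫ ω, ‖X ω‖ ^ 2 ∂P := by
    have hsq : Measurable (fun z : ℂ => ‖z‖ ^ 2) := by fun_prop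
    exact (hind.comp hsq hsq).integral_fun_mul_eq_mul_integral
      (hsq.comp hS).aestronglyMeasurable (hsq.comp hX).aestronglyMeasurable
  have i1 := hpow S C 4 hS hSC
  have i2 := hpow X C' 4 hX hXC
  have i0 := hpow (fun ω => S ω + X ω) (C + C') 4 (hS.add hX) fun ω =>
    (norm_add_le _ _).trans (add_le_add (hSC ω) (hXC ω))
  have i3 : Integrable (fun ω => 6 * (‖S ω‖ ^ 2 * ‖X ω‖ ^ 2)) P := by
    refine Integrable.const_mul ?_ _
    refine integrable_of_measurable_of_norm_le (by fun_prop) (C := C ^ 2 * C' ^ 2) fun ω => ?_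
    rw [norm_mul, norm_pow, norm_pow, norm_norm, norm_norm]
    gcongr
    · exact hSC ω
    · exact hXC ω
  have hC0 : ∀ ω, 0 ≤ C := fun ω => (norm_nonneg _).trans (hSC ω)
  have i4 : Integrable (fun ω => 4 * ((starRingEnd ℂ) (S ω) * (‖S ω‖ ^ 2 : ℝ) * X ω).re) P := by
    refine Integrable.const_mul ?_ _
    refine integrable_of_measurable_of_norm_le (C := C * C ^ 2 * C') ?_ fun ω => ?_
    · exact Complex.measurable_re.comp ((hm1.comp hS).mul hX)
    · refine (Complex.abs_re_le_norm _).trans ?_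
      have := hC0 ω
      rw [norm_mul, norm_mul, Complex.norm_conj, Complex.norm_real, norm_pow, norm_norm]
      gcongr
      · exact hSC ω
      · exact hSC ω
      · exact hXC ω
  have i5 : Integrable (fun ω => 4 * ((starRingEnd ℂ) (S ω) * (X ω * (‖X ω‖ ^ 2 : ℝ))).re) P := by
    refine Integrable.const_mul ?_ _
    refine integrable_of_measurable_of_norm_le (C := C * (C' * C' ^ 2)) ?_ fun ω => ?_
    · exact Complex.measurable_re.comp ((hm.comp hS).mul (hm2.comp hX))
    · refine (Complex.abs_re_le_norm _).trans ?_
      have := hC0 ω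
      have := (norm_nonneg _).trans (hXC ω)
      rw [norm_mul, norm_mul, Complex.norm_conj, Complex.norm_real, norm_pow, norm_norm]
      gcongr
      · exact hSC ω
      · exact hXC ω
      · exact hXC ω
  refine (integral_mono i0 ((((i1.add i3).add i2).add i4).add i5)
    fun ω => norm_add_pow_four_le (S ω) (X ω)).trans ?_
  have i13 : Integrable (fun ω => ‖S ω‖ ^ 4 + 6 * (‖S ω‖ ^ 2 * ‖X ω‖ ^ 2)) P := i1.add i3
  have i132 : Integrable (fun ω => ‖S ω‖ ^ 4 + 6 * (‖S ω‖ ^ 2 * ‖X ω‖ ^ 2) + ‖X ω‖ ^ 4) P :=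
    i13.add i2
  have i1324 : Integrable (fun ω => ‖S ω‖ ^ 4 + 6 * (‖S ω‖ ^ 2 * ‖X ω‖ ^ 2) + ‖X ω‖ ^ 4
      + 4 * ((starRingEnd ℂ) (S ω) * (‖S ω‖ ^ 2 : ℝ) * X ω).re) P := i132.add i4
  simp only [Pi.add_apply]
  rw [integral_add i1324 i5, integral_add i132 i4, integral_add i13 i2, integral_add i1 i3, integral_const_mul, integral_const_mul,
    integral_const_mul, j3]
  simp only [Function.comp_apply] at h1 h2
  rw [h1, h2]
  simp

namespace IsMaskFamily

variable {ι : Type*} {ξ : ι → Ω → ℂ} {ν : ℝ}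

lemma integrable (hξ : IsMaskFamily P ξ ν) (i : ι) : Integrable (ξ i) P :=
  integrable_of_measurable_of_norm_le (hξ.meas i) (hξ.norm_le i)

lemma integral_sum_eq_zero (hξ : IsMaskFamily P ξ ν) (a : ι → ℂ) (s : Finset ι) :
    ∫ ω, ∑ i ∈ s, a i * ξ i ω ∂P = 0 := by
  rw [integral_finsetSum _ fun i _ => (hξ.integrable i).const_mul _]
  simp [integral_const_mul, hξ.mean_zero]

/-- Second and fourth moment of a linear combination of masks. -/
lemma moments (hξ : IsMaskFamily P ξ ν) (a : ι → ℂ) (s : Finset ι) (hν : 1 ≤ ν) :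
    ∫ ω, ‖∑ i ∈ s, a i * ξ i ω‖ ^ 2 ∂P = ∑ i ∈ s, ‖a i‖ ^ 2 ∧
    ∫ ω, ‖∑ i ∈ s, a i * ξ i ω‖ ^ 4 ∂P ≤ 3 * ν ^ 2 * (∑ i ∈ s, ‖a i‖ ^ 2) ^ 2 := by
  classical
  induction s using Finset.induction_on with
  | empty => simp
  | insert i s hi ih =>
    obtain ⟨ih2, ih4⟩ := ih
    have hX : Measurable (fun ω => a i * ξ i ω) := (hξ.meas i).const_mul _
    have hX0 : ∫ ω, a i * ξ i ω ∂P = 0 := by rw [integral_const_mul, hξ.mean_zero, mul_zero]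
    have hXC : ∀ ω, ‖a i * ξ i ω‖ ≤ ‖a i‖ * ν := fun ω => by
      rw [norm_mul]; exact mul_le_mul_of_nonneg_left (hξ.norm_le i ω) (norm_nonneg _)
    have hX2 : ∫ ω, ‖a i * ξ i ω‖ ^ 2 ∂P = ‖a i‖ ^ 2 := by
      simp_rw [norm_mul, mul_pow]
      rw [integral_const_mul, hξ.second_moment, mul_one]
    have hX4 : ∫ ω, ‖a i * ξ i ω‖ ^ 4 ∂P ≤ ν ^ 2 * ‖a i‖ ^ 4 := by
      have : ∀ ω, ‖a i * ξ i ω‖ ^ 4 ≤ ν ^ 2 * ‖a i‖ ^ 2 * ‖a i * ξ i ω‖ ^ 2 := fun ω => by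
        have := pow_le_pow_left₀ (norm_nonneg _) (hXC ω) 2
        nlinarith [sq_nonneg ‖a i * ξ i ω‖]
      refine (integral_mono ?_ ?_ this).trans (le_of_eq ?_)
      · exact integrable_of_measurable_of_norm_le (by fun_prop) (C := (‖a i‖ * ν) ^ 4) fun ω => by
          simpa using pow_le_pow_left₀ (norm_nonneg _) (hXC ω) 4
      · refine Integrable.const_mul ?_ _
        exact integrable_of_measurable_of_norm_le (by fun_prop) (C := (‖a i‖ * ν) ^ 2) fun ω => by
          simpa using pow_le_pow_left₀ (norm_nonneg _) (hXC ω) 2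
      · rw [integral_const_mul, hX2]; ring
    have hS := hξ.measurable_sum a s
    have h2 := integral_norm_add_sq hS hX (hξ.indepFun_sum a hi) hX0 (hξ.norm_sum_le a s) hXC
    have h4 := integral_norm_add_pow_four_le hS hX (hξ.indepFun_sum a hi)
      (hξ.integral_sum_eq_zero a s) hX0 (hξ.norm_sum_le a s) hXC
    simp_rw [Finset.sum_insert hi, add_comm (a i * ξ i _)]
    rw [ih2, hX2] at h2 h4
    refine ⟨by rw [h2, add_comm], h4.trans ?_⟩
    have hA : 0 ≤ ∑ i ∈ s, ‖a i‖ ^ 2 := Finset.sum_nonneg fun _ _ => sq_nonneg _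
    set A := ∑ i ∈ s, ‖a i‖ ^ 2
    have hν2 : 1 ≤ ν ^ 2 := one_le_pow₀ hν
    have hb : 0 ≤ ‖a i‖ ^ 2 := sq_nonneg _
    nlinarith [mul_nonneg hA hb, mul_nonneg (mul_nonneg hA hb) (sub_nonneg.2 hν2),
      mul_nonneg hb hb, mul_nonneg (sub_nonneg.2 hν2) (mul_nonneg hb hb)]

/-- One-sided control of the Laplace transform, from `exp (-z) ≤ 1 - z + z² / 2` for `z ≥ 0`. -/
lemma integral_exp_neg_le (hξ : IsMaskFamily P ξ ν) (a : ι → ℂ) (s : Finset ι) (hν : 1 ≤ ν)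
    (ha : ∑ i ∈ s, ‖a i‖ ^ 2 = 1) {θ : ℝ} (hθ : 0 ≤ θ) :
    ∫ ω, Real.exp (-(θ * ‖∑ i ∈ s, a i * ξ i ω‖ ^ 2)) ∂P
      ≤ Real.exp (-θ + 3 * ν ^ 2 * θ ^ 2 / 2) := by
  obtain ⟨h2, h4⟩ := hξ.moments a s hν
  rw [ha] at h2 h4
  have hS := hξ.measurable_sum a s
  have hC := hξ.norm_sum_le a s
  set S := fun ω => ∑ i ∈ s, a i * ξ i ω
  have hpow : ∀ k, Integrable (fun ω => ‖S ω‖ ^ k) P := fun k =>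
    integrable_of_measurable_of_norm_le (by fun_prop) fun ω => by
      simpa using pow_le_pow_left₀ (norm_nonneg _) (hC ω) k
  have hexp : ∀ z : ℝ, 0 ≤ z → Real.exp (-z) ≤ 1 - z + z ^ 2 / 2 := fun z hz => by
    have h := Real.quadratic_le_exp_of_nonneg hz
    rw [Real.exp_neg]
    have h0 : 0 < 1 + z + z ^ 2 / 2 := by positivity
    refine (inv_anti₀ h0 h).trans ?_
    rw [inv_le_iff_one_le_mul₀ h0]
    nlinarith [sq_nonneg (z ^ 2)]
  have key : ∀ ω, Real.exp (-(θ * ‖S ω‖ ^ 2)) ≤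
      1 - θ * ‖S ω‖ ^ 2 + θ ^ 2 / 2 * ‖S ω‖ ^ 4 := fun ω => by
    refine (hexp _ (by positivity)).trans (le_of_eq (by ring))
  have i0 : Integrable (fun ω => Real.exp (-(θ * ‖S ω‖ ^ 2))) P :=
    integrable_of_measurable_of_norm_le (by fun_prop) (C := 1) fun ω => by
      rw [Real.norm_eq_abs, abs_of_pos (Real.exp_pos _), Real.exp_le_one_iff]
      have : 0 ≤ θ * ‖S ω‖ ^ 2 := by positivity
      linarith
  have i1 : Integrable (fun ω => 1 - θ * ‖S ω‖ ^ 2) P :=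
    (integrable_const _).sub ((hpow 2).const_mul θ)
  have i2 : Integrable (fun ω => θ ^ 2 / 2 * ‖S ω‖ ^ 4) P := (hpow 4).const_mul _
  refine (integral_mono i0 (i1.add i2) key).trans ?_
  simp only [Pi.add_apply]
  rw [integral_add i1 i2, integral_sub (integrable_const _) ((hpow 2).const_mul θ),
    integral_const_mul, integral_const_mul, h2]
  have := Real.add_one_le_exp (-θ + 3 * ν ^ 2 * θ ^ 2 / 2)
  simp only [integral_const, probReal_univ, smul_eq_mul, mul_one]
  nlinarith [mul_le_mul_of_nonneg_left h4 (sq_nonneg θ)]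

end IsMaskFamily

end Probability

/-! ### A grid in the unit ball -/

section GridNet

lemma norm_toEuclideanLin_sq {n L : ℕ} (D : Matrix (Fin n) (Fin L) ℂ)
    (z : EuclideanSpace ℂ (Fin L)) :
    ‖Matrix.toEuclideanLin D z‖ ^ 2 = ∑ k, ‖∑ l, z l * D k l‖ ^ 2 := by
  rw [EuclideanSpace.norm_sq_eq]
  refine Finset.sum_congr rfl fun k _ => ?_
  congr 2
  simp [Matrix.toLpLin_apply, Matrix.mulVec, dotProduct, mul_comm]

/-- The point `(p + i q) / N` of `ℂ ^ L` with integer coordinates `p`, `q`. -/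
noncomputable def gridPoint {L : ℕ} (N : ℕ) (m : Fin L → ℤ × ℤ) : EuclideanSpace ℂ (Fin L) :=
  WithLp.toLp 2 fun l => (((m l).1 / N : ℝ) : ℂ) + (((m l).2 / N : ℝ) : ℂ) * Complex.I

/-- The integer coordinates of the grid points in the cube `max (|Re|, |Im|) ≤ 1`. -/
noncomputable def gridIndex (L N : ℕ) : Finset (Fin L → ℤ × ℤ) :=
  Fintype.piFinset fun _ => Finset.Icc (-(N : ℤ)) N ×ˢ Finset.Icc (-(N : ℤ)) N

lemma card_gridIndex (L N : ℕ) : (gridIndex L N).card = (2 * N + 1) ^ (2 * L) := by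
  have h : ((N : ℤ) + 1 - -(N : ℤ)).toNat = 2 * N + 1 := by omega
  rw [gridIndex, Fintype.card_piFinset]
  simp only [Finset.card_product, Int.card_Icc, Finset.prod_const, Finset.card_univ,
    Fintype.card_fin, h]
  rw [← sq, ← pow_mul]

lemma exists_int_div_near {N : ℕ} (hN : 0 < N) {t : ℝ} (ht : |t| ≤ 1) :
    ∃ m : ℤ, m ∈ Finset.Icc (-(N : ℤ)) N ∧ |t - m / N| ≤ 1 / N := by
  have hN' : (0 : ℝ) < N := by exact_mod_cast hN
  obtain ⟨h1, h2⟩ := abs_le.1 ht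
  refine ⟨⌊t * N⌋, ?_, ?_⟩
  · rw [Finset.mem_Icc]
    constructor
    · rw [Int.le_floor]; push_cast; nlinarith
    · have : (⌊t * N⌋ : ℝ) ≤ N := (Int.floor_le _).trans (by nlinarith)
      exact_mod_cast this
  · have h3 := Int.floor_le (t * N)
    have h4 := Int.lt_floor_add_one (t * N)
    have h5 : t - ⌊t * N⌋ / N = (t * N - ⌊t * N⌋) / N := by field_simp
    rw [h5, abs_of_nonneg (div_nonneg (by linarith) hN'.le)]
    gcongr
    linarith

lemma exists_gridPoint_near {L N : ℕ} (hN : 0 < N) {z : EuclideanSpace ℂ (Fin L)}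
    (hz : ‖z‖ ≤ 1) : ∃ m ∈ gridIndex L N, ∀ l, ‖(z - gridPoint N m) l‖ ≤ 2 / N := by
  have hzl : ∀ l, ‖z l‖ ≤ 1 := fun l => (PiLp.norm_apply_le z l).trans hz
  choose p hp hp' using fun l => exists_int_div_near hN ((Complex.abs_re_le_norm _).trans (hzl l))
  choose q hq hq' using fun l => exists_int_div_near hN ((Complex.abs_im_le_norm _).trans (hzl l))
  refine ⟨fun l => (p l, q l), ?_, fun l => ?_⟩
  · rw [gridIndex, Fintype.mem_piFinset]
    exact fun l => Finset.mem_product.2 ⟨hp l, hq l⟩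
  · refine (Complex.norm_le_abs_re_add_abs_im _).trans ?_
    have := add_le_add (hp' l) (hq' l)
    have e : (1 : ℝ) / N + 1 / N = 2 / N := by ring
    rw [e] at this
    convert! this using 2
    · simp [gridPoint]
    · simp [gridPoint]

lemma norm_le_sqrt_mul_of_forall_le {L : ℕ} {e : EuclideanSpace ℂ (Fin L)} {δ : ℝ} (hδ : 0 ≤ δ)
    (he : ∀ l, ‖e l‖ ≤ δ) : ‖e‖ ≤ Real.sqrt L * δ := by
  refine le_of_sq_le_sq ?_ (by positivity)
  rw [mul_pow, Real.sq_sqrt (Nat.cast_nonneg _), EuclideanSpace.norm_sq_eq]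
  refine (Finset.sum_le_sum fun l _ => pow_le_pow_left₀ (norm_nonneg _) (he l) 2).trans ?_
  simp

lemma norm_toEuclideanLin_le {n L : ℕ} {D : Matrix (Fin n) (Fin L) ℂ} {ν δ : ℝ}
    (hD : ∀ k l, ‖D k l‖ ≤ ν) (hν : 0 ≤ ν) (hδ : 0 ≤ δ) {e : EuclideanSpace ℂ (Fin L)}
    (he : ∀ l, ‖e l‖ ≤ δ) :
    ‖Matrix.toEuclideanLin D e‖ ≤ Real.sqrt n * (L * (δ * ν)) := by
  refine norm_le_sqrt_mul_of_forall_le (by positivity) fun k => ?_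
  have : (Matrix.toEuclideanLin D e) k = ∑ l, e l * D k l := by
    simp [Matrix.toLpLin_apply, Matrix.mulVec, dotProduct, mul_comm]
  rw [this]
  refine (norm_sum_le _ _).trans ?_
  refine (Finset.sum_le_sum fun l _ => ?_).trans (b := ∑ _l : Fin L, δ * ν) (by simp)
  rw [norm_mul]
  exact mul_le_mul (he l) (hD k l) (norm_nonneg _) hδ

/-- A lower bound for `‖D z‖` on the grid extends to all `z`: in the sup norm the grid is
`1 / (20 ν L)`-dense, which changes `‖D z‖` by at most `√n / 20`. -/
lemma norm_toEuclideanLin_ge_of_grid {n L N : ℕ} {D : Matrix (Fin n) (Fin L) ℂ} {ν : ℝ}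
    (hν : 1 ≤ ν) (hL : 1 ≤ L) (hD : ∀ k l, ‖D k l‖ ≤ ν) (hN : 40 * (ν * L) ≤ N)
    (hgrid : ∀ m ∈ gridIndex L N, gridPoint N m ≠ 0 →
      n / 9 * ‖gridPoint N m‖ ^ 2 ≤ ‖Matrix.toEuclideanLin D (gridPoint N m)‖ ^ 2)
    (z : EuclideanSpace ℂ (Fin L)) :
    Real.sqrt n / 4 * ‖z‖ ≤ ‖Matrix.toEuclideanLin D z‖ := by
  have hL' : (1 : ℝ) ≤ L := by exact_mod_cast hL
  have hνL : 1 ≤ ν * L := by nlinarith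
  have hN0 : (0 : ℝ) < N := by linarith
  -- By homogeneity only unit vectors have to be treated.
  have unit : ∀ w : EuclideanSpace ℂ (Fin L), ‖w‖ = 1 →
      Real.sqrt n / 4 ≤ ‖Matrix.toEuclideanLin D w‖ := by
    intro w hw
    obtain ⟨m, hm, hmw⟩ := exists_gridPoint_near (N := N) (by exact_mod_cast hN0) hw.le
    set g := gridPoint N m
    have hδ : (2 : ℝ) / N * (L * ν) ≤ 1 / 20 := by
      rw [div_mul_eq_mul_div, div_le_iff₀ hN0]; linarith
    have hδ0 : (0 : ℝ) ≤ 2 / N := by positivity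
    have h1 := norm_le_sqrt_mul_of_forall_le hδ0 hmw
    have h2 := norm_toEuclideanLin_le hD (by linarith) hδ0 hmw
    have h3 : Real.sqrt L ≤ L * ν := by
      have : Real.sqrt L ≤ L := by
        rw [Real.sqrt_le_left (by linarith)]; nlinarith
      nlinarith
    have h4 : ‖w - g‖ ≤ 1 / 20 := by nlinarith
    have h5 : 19 / 20 ≤ ‖g‖ := by
      have := norm_sub_norm_le w g
      linarith
    have h6 : Real.sqrt n / 3 * ‖g‖ ≤ ‖Matrix.toEuclideanLin D g‖ := by
      refine le_of_sq_le_sq ?_ (norm_nonneg _)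
      have h := hgrid m hm (by rw [← norm_pos_iff]; linarith)
      rw [mul_pow, div_pow, Real.sq_sqrt (Nat.cast_nonneg _)]
      norm_num
      exact h
    have h7 : ‖Matrix.toEuclideanLin D g‖ ≤ ‖Matrix.toEuclideanLin D w‖
        + ‖Matrix.toEuclideanLin D (w - g)‖ := by
      rw [map_sub]
      have := norm_sub_norm_le (Matrix.toEuclideanLin D g) (Matrix.toEuclideanLin D w)
      rw [norm_sub_rev] at this
      linarith
    have hs := Real.sqrt_nonneg (n : ℝ)
    have h8 : Real.sqrt n * (L * (2 / N * ν)) ≤ Real.sqrt n / 20 := by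
      have : L * (2 / N * ν) ≤ 1 / 20 := by linarith
      nlinarith
    nlinarith
  rcases eq_or_ne z 0 with rfl | hz
  · simp
  have hz' : 0 < ‖z‖ := norm_pos_iff.2 hz
  have h := unit (((‖z‖⁻¹ : ℝ) : ℂ) • z) (by
    rw [norm_smul, Complex.norm_real, norm_inv, norm_norm, inv_mul_cancel₀ hz'.ne'])
  rw [map_smul, norm_smul, Complex.norm_real, norm_inv, norm_norm] at h
  rwa [inv_mul_eq_div, le_div_iff₀ hz'] at h

end GridNet

/-! ### Tail bounds for the mask matrix -/

section Tails

variable {Ω : Type*} [MeasurableSpace Ω] {P : Measure Ω} [IsProbabilityMeasure P]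

namespace IsMaskFamily

lemma measureReal_le_re_sum_le {ι : Type*} [Fintype ι] {ξ : ι → Ω → ℂ} {ν : ℝ}
    (hξ : IsMaskFamily P ξ ν) (hν : 1 ≤ ν) (a : ι → ℂ)
    (ha : ∑ i, ‖a i‖ ^ 2 = 1) {t : ℝ} (ht : 0 ≤ t) :
    P.real {ω | t ≤ (∑ i, a i * ξ i ω).re} ≤ Real.exp (-t ^ 2 / (2 * ν ^ 2)) := by
  have hind := hξ.indep.comp (fun i z => (a i * z).re)
    (fun i => Complex.measurable_re.comp (measurable_const_mul _))
  have hsub : ∀ i ∈ Finset.univ, HasSubgaussianMGF ((fun z => (a i * z).re) ∘ ξ i)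
      ((‖‖a i‖ * ν - -(‖a i‖ * ν)‖₊ / 2) ^ 2) P := by
    intro i _
    refine hasSubgaussianMGF_of_mem_Icc_of_integral_eq_zero ?_ ?_ ?_
    · exact (Complex.measurable_re.comp ((hξ.meas i).const_mul _)).aemeasurable
    · refine Filter.Eventually.of_forall fun ω => abs_le.1 ?_
      refine (Complex.abs_re_le_norm _).trans ?_
      rw [norm_mul]
      exact mul_le_mul_of_nonneg_left (hξ.norm_le i ω) (norm_nonneg _)
    · have h := integral_re (𝕜 := ℂ) ((hξ.integrable i).const_mul (a i))
      rw [integral_const_mul, hξ.mean_zero, mul_zero] at h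
      simpa using h
  have h := HasSubgaussianMGF.measure_sum_ge_le_of_iIndepFun hind hsub ht
  have hc : (∑ i, ((‖‖a i‖ * ν - -(‖a i‖ * ν)‖₊ / 2) ^ 2 : NNReal) : NNReal) = ν ^ 2 := by
    push_cast
    rw [← mul_one (ν ^ 2), ← ha, Finset.mul_sum]
    refine Finset.sum_congr rfl fun i _ => ?_
    rw [sub_neg_eq_add, Real.norm_of_nonneg (by positivity)]
    ring
  push_cast at h hc
  rw [hc] at h
  simpa using h

/-- Hoeffding's inequality for complex linear combinations of masks, from the four real ones. -/
lemma measureReal_le_norm_sum_le {ι : Type*} [Fintype ι] {ξ : ι → Ω → ℂ} {ν : ℝ}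
    (hξ : IsMaskFamily P ξ ν) (hν : 1 ≤ ν) (a : ι → ℂ)
    (ha : ∑ i, ‖a i‖ ^ 2 = 1) {t : ℝ} (ht : 0 ≤ t) :
    P.real {ω | Real.sqrt 2 * t < ‖∑ i, a i * ξ i ω‖} ≤ 4 * Real.exp (-t ^ 2 / (2 * ν ^ 2)) := by
  have hc : ∀ c : ℂ, ‖c‖ = 1 → P.real {ω | t ≤ (c * ∑ i, a i * ξ i ω).re}
      ≤ Real.exp (-t ^ 2 / (2 * ν ^ 2)) := by
    intro c hc
    have := hξ.measureReal_le_re_sum_le hν (fun i => c * a i) (by simpa [hc] using ha) ht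
    simpa only [Finset.mul_sum, mul_assoc] using this
  have h1 := hc 1 (by simp)
  have h2 := hc (-1) (by simp)
  have h3 := hc Complex.I (by simp)
  have h4 := hc (-Complex.I) (by simp)
  refine (measureReal_mono (s₂ := (({ω | t ≤ (1 * ∑ i, a i * ξ i ω).re} ∪
    {ω | t ≤ (-1 * ∑ i, a i * ξ i ω).re}) ∪ {ω | t ≤ (Complex.I * ∑ i, a i * ξ i ω).re}) ∪
    {ω | t ≤ (-Complex.I * ∑ i, a i * ξ i ω).re}) ?_).trans ?_
  · intro ω hω
    simp only [Set.mem_union, Set.mem_ofPred_eq] at hω ⊢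
    by_contra! h
    obtain ⟨⟨⟨g1, g2⟩, g3⟩, g4⟩ := h
    set s := ∑ i, a i * ξ i ω
    simp at g1 g2 g3 g4
    have hs : ‖s‖ ^ 2 = s.re ^ 2 + s.im ^ 2 := by
      rw [← Complex.normSq_eq_norm_sq, Complex.normSq_apply]; ring
    have := pow_lt_pow_left₀ hω (by positivity) (two_ne_zero)
    rw [mul_pow, Real.sq_sqrt (by norm_num), hs] at this
    nlinarith
  · have u1 := measureReal_union_le (μ := P) {ω | t ≤ (1 * ∑ i, a i * ξ i ω).re}
      {ω | t ≤ (-1 * ∑ i, a i * ξ i ω).re}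
    have u2 := measureReal_union_le (μ := P) ({ω | t ≤ (1 * ∑ i, a i * ξ i ω).re} ∪
      {ω | t ≤ (-1 * ∑ i, a i * ξ i ω).re}) {ω | t ≤ (Complex.I * ∑ i, a i * ξ i ω).re}
    have u3 := measureReal_union_le (μ := P) (({ω | t ≤ (1 * ∑ i, a i * ξ i ω).re} ∪
      {ω | t ≤ (-1 * ∑ i, a i * ξ i ω).re}) ∪ {ω | t ≤ (Complex.I * ∑ i, a i * ξ i ω).re})
      {ω | t ≤ (-Complex.I * ∑ i, a i * ξ i ω).re}
    linarith

variable {n L : ℕ} {ξ : Fin n × Fin L → Ω → ℂ} {ν : ℝ}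

lemma integral_exp_neg_rows_le (hξ : IsMaskFamily P ξ ν) (hν : 1 ≤ ν) (z : Fin L → ℂ)
    (hz : ∑ l, ‖z l‖ ^ 2 = 1) {θ : ℝ} (hθ : 0 ≤ θ) (s : Finset (Fin n)) :
    ∫ ω, Real.exp (-(θ * ∑ k ∈ s, ‖∑ l, z l * ξ (k, l) ω‖ ^ 2)) ∂P
      ≤ Real.exp (-θ + 3 * ν ^ 2 * θ ^ 2 / 2) ^ s.card := by
  classical
  induction s using Finset.induction_on with
  | empty => simp
  | insert k s hk ih =>
    -- The rows in `s` and the row `k` use disjoint sets of masks.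
    have hdisj : Disjoint (s ×ˢ (Finset.univ : Finset (Fin L))) ({k} ×ˢ Finset.univ) := by
      rw [Finset.disjoint_product]
      exact Or.inl (by simpa using hk)
    have hind := hξ.indep.indepFun_finset _ _ hdisj hξ.meas
    let φ : ((s ×ˢ (Finset.univ : Finset (Fin L)) : Finset _) → ℂ) → ℝ := fun v =>
      Real.exp (-(θ * ∑ j ∈ s.attach, ‖∑ l, z l * v ⟨(j, l), by simp⟩‖ ^ 2))
    let ψ : ((({k} : Finset (Fin n)) ×ˢ (Finset.univ : Finset (Fin L)) : Finset _) → ℂ) → ℝ :=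
      fun v => Real.exp (-(θ * ‖∑ l, z l * v ⟨(k, l), by simp⟩‖ ^ 2))
    have hφ : Measurable φ := by fun_prop
    have hψ : Measurable ψ := by fun_prop
    have h1 := (hind.comp hφ hψ).integral_fun_mul_eq_mul_integral
      (hφ.comp (measurable_pi_lambda _ fun i => hξ.meas _)).aestronglyMeasurable
      (hψ.comp (measurable_pi_lambda _ fun i => hξ.meas _)).aestronglyMeasurable
    have hattach : ∀ ω, ∑ j ∈ s.attach, ‖∑ l, z l * ξ (j.1, l) ω‖ ^ 2
        = ∑ j ∈ s, ‖∑ l, z l * ξ (j, l) ω‖ ^ 2 := fun ω =>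
      Finset.sum_attach s fun j => ‖∑ l, z l * ξ (j, l) ω‖ ^ 2
    simp only [Function.comp_apply, φ, ψ, hattach] at h1
    have h2 : ∀ ω, Real.exp (-(θ * ∑ j ∈ insert k s, ‖∑ l, z l * ξ (j, l) ω‖ ^ 2))
        = Real.exp (-(θ * ∑ j ∈ s, ‖∑ l, z l * ξ (j, l) ω‖ ^ 2))
          * Real.exp (-(θ * ‖∑ l, z l * ξ (k, l) ω‖ ^ 2)) := fun ω => by
      rw [← Real.exp_add, Finset.sum_insert hk]; ring_nf
    simp_rw [h2]
    rw [h1, Finset.card_insert_of_notMem hk, pow_succ]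
    have hrow := (hξ.precomp (f := fun l : Fin L => (k, l))
      (fun _ _ h => (Prod.mk.inj h).2)).integral_exp_neg_le z Finset.univ hν hz hθ
    exact mul_le_mul ih hrow (integral_nonneg fun _ => (Real.exp_pos _).le) (by positivity)

/-- Lower tail of `‖D z‖²` for a unit vector `z`: Chernoff's bound at `θ = 8 / (27 ν²)`, which
minimises `-8θ/9 + 3ν²θ²/2`. -/
lemma measureReal_rows_le (hξ : IsMaskFamily P ξ ν) (hν : 1 ≤ ν) (z : Fin L → ℂ)
    (hz : ∑ l, ‖z l‖ ^ 2 = 1) :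
    P.real {ω | ∑ k, ‖∑ l, z l * ξ (k, l) ω‖ ^ 2 ≤ n / 9}
      ≤ Real.exp (-(32 / 243 * (n / ν ^ 2))) := by
  have hν0 : 0 < ν := by linarith
  set θ : ℝ := 8 / (27 * ν ^ 2) with hθdef
  have hθ : 0 ≤ θ := by positivity
  have hm : Measurable fun ω => ∑ k, ‖∑ l, z l * ξ (k, l) ω‖ ^ 2 :=
    Finset.measurable_sum _ fun k _ => Measurable.pow_const (Measurable.norm
      (Finset.measurable_sum _ fun l _ => (hξ.meas _).const_mul _)) 2
  have hint : Integrable (fun ω => Real.exp (-θ * ∑ k, ‖∑ l, z l * ξ (k, l) ω‖ ^ 2)) P :=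
    integrable_of_measurable_of_norm_le (by fun_prop) (C := 1) fun ω => by
      rw [Real.norm_eq_abs, abs_of_pos (Real.exp_pos _), Real.exp_le_one_iff]
      have : 0 ≤ θ * ∑ k, ‖∑ l, z l * ξ (k, l) ω‖ ^ 2 := by positivity
      linarith
  have h1 := measure_le_le_exp_mul_mgf ((n : ℝ) / 9) (neg_nonpos.2 hθ) hint
  have h2 := hξ.integral_exp_neg_rows_le hν z hz hθ Finset.univ
  refine h1.trans ?_
  rw [mgf]
  simp_rw [neg_mul]
  refine (mul_le_mul_of_nonneg_left h2 (Real.exp_pos _).le).trans (le_of_eq ?_)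
  rw [Finset.card_univ, Fintype.card_fin, ← Real.exp_nat_mul, ← Real.exp_add]
  congr 1
  rw [hθdef]
  field_simp
  ring

/-- With probability at least `1 - 1/n` every singular value of the mask matrix is at least
`√n / 4`.  The grid has at most `n ^ (2 L) ≤ exp (n / (16 ν²))` points, which the exponent
`32 / 243 > 1 / 16 + 1 / 32` of the lower tail outweighs. -/
lemma measureReal_exists_norm_lt_le (hξ : IsMaskFamily P ξ ν) (hν : 1 ≤ ν) (hL : 1 ≤ L)
    (hn : 160 * (ν * L) ≤ n) (hlog : 32 * ν ^ 2 * L * Real.log n ≤ n) :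
    P.real {ω | ∃ z : EuclideanSpace ℂ (Fin L),
      ‖Matrix.toEuclideanLin (Matrix.of fun k l => ξ (k, l) ω) z‖ < Real.sqrt n / 4 * ‖z‖}
      ≤ 1 / n := by
  have hL' : (1 : ℝ) ≤ L := by exact_mod_cast hL
  have hνL : 1 ≤ ν * L := by nlinarith
  have hn0 : (0 : ℝ) < n := by linarith
  have hn1 : 1 ≤ n := by exact_mod_cast hn0
  have hν2 : 0 < ν ^ 2 := by positivity
  set N := (n - 1) / 2 with hNdef
  have hN1 : 2 * N + 1 ≤ n := by omega
  have hN2 : n ≤ 2 * N + 2 := by omega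
  have hN2' : (n : ℝ) ≤ 2 * N + 2 := by exact_mod_cast hN2
  have hN : 40 * (ν * L) ≤ N := by linarith
  let bad : (Fin L → ℤ × ℤ) → Set Ω := fun m => {ω | gridPoint N m ≠ 0 ∧
    ‖Matrix.toEuclideanLin (Matrix.of fun k l => ξ (k, l) ω) (gridPoint N m)‖ ^ 2
      < n / 9 * ‖gridPoint N m‖ ^ 2}
  have hsub : {ω | ∃ z : EuclideanSpace ℂ (Fin L),
      ‖Matrix.toEuclideanLin (Matrix.of fun k l => ξ (k, l) ω) z‖ < Real.sqrt n / 4 * ‖z‖}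
      ⊆ ⋃ m ∈ gridIndex L N, bad m := by
    rintro ω ⟨z, hz⟩
    by_contra hω
    simp only [Set.mem_iUnion, not_exists, bad, Set.mem_ofPred_eq, not_and, not_lt] at hω
    exact absurd (norm_toEuclideanLin_ge_of_grid hν hL (fun k l => hξ.norm_le (k, l) ω) hN
      hω z) (not_le.2 hz)
  have hbad : ∀ m ∈ gridIndex L N, P.real (bad m) ≤ Real.exp (-(32 / 243 * (n / ν ^ 2))) := by
    intro m _
    rcases eq_or_ne (gridPoint N m) 0 with h0 | h0
    · simp [bad, h0]; positivity
    have hg : 0 < ‖gridPoint N m‖ := norm_pos_iff.2 h0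
    set w : EuclideanSpace ℂ (Fin L) := ((‖gridPoint N m‖⁻¹ : ℝ) : ℂ) • gridPoint N m with hw
    have hw1 : ‖w‖ = 1 := by
      rw [hw, norm_smul, Complex.norm_real, norm_inv, norm_norm, inv_mul_cancel₀ hg.ne']
    refine (measureReal_mono ?_).trans (hξ.measureReal_rows_le hν w.ofLp ?_)
    · rintro ω ⟨-, hω⟩
      have := norm_toEuclideanLin_sq (Matrix.of fun k l => ξ (k, l) ω) w
      simp only [Matrix.of_apply] at this
      simp only [Set.mem_ofPred_eq]
      rw [← this, hw, map_smul, norm_smul, Complex.norm_real, norm_inv, norm_norm, mul_pow,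
        inv_pow, inv_mul_le_iff₀ (by positivity), mul_comm]
      exact hω.le
    · rw [← EuclideanSpace.norm_sq_eq, hw1, one_pow]
  refine (measureReal_mono hsub (measure_ne_top P _)).trans ((measureReal_biUnion_finset_le _ _).trans
    ((Finset.sum_le_sum hbad).trans ?_))
  rw [Finset.sum_const, nsmul_eq_mul, card_gridIndex]
  have hcard : (((2 * N + 1) ^ (2 * L) : ℕ) : ℝ) ≤ Real.exp (2 * L * Real.log n) := by
    have h1 : (((2 * N + 1) ^ (2 * L) : ℕ) : ℝ) ≤ (n : ℝ) ^ (2 * L) := by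
      exact_mod_cast Nat.pow_le_pow_left hN1 _
    refine h1.trans (le_of_eq ?_)
    rw [← Real.rpow_natCast, Real.rpow_def_of_pos hn0]
    push_cast
    ring_nf
  refine (mul_le_mul_of_nonneg_right hcard (Real.exp_pos _).le).trans ?_
  rw [← Real.exp_add, one_div, ← Real.exp_log hn0, ← Real.exp_neg, Real.exp_log hn0,
    Real.exp_le_exp]
  have hlog0 : 0 ≤ Real.log n := Real.log_nonneg (by exact_mod_cast hn1)
  have hx : 32 * (L * Real.log n) ≤ n / ν ^ 2 := by
    rw [le_div_iff₀ hν2]; linarith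
  nlinarith

/-- With probability at least `1 - 1/n` all combinations of the columns of the mask matrix with the
`n` unit coefficient vectors `a j` are `O(ν √(log n))`. -/
lemma measureReal_exists_lt_norm_sum_le (hξ : IsMaskFamily P ξ ν) (hν : 1 ≤ ν)
    (hn : 4 * L ≤ n) (hn1 : 1 ≤ n) (a : Fin n → Fin n → ℂ) (ha : ∀ j, ∑ k, ‖a j k‖ ^ 2 = 1) :
    P.real {ω | ∃ j l, ν * Real.sqrt (12 * Real.log n) < ‖∑ k, a j k * ξ (k, l) ω‖}
      ≤ 1 / n := by
  have hn0 : (0 : ℝ) < n := by exact_mod_cast hn1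
  have hν0 : 0 < ν := by linarith
  have hlog0 : 0 ≤ Real.log n := Real.log_nonneg (by exact_mod_cast hn1)
  have hsub : {ω | ∃ j l, ν * Real.sqrt (12 * Real.log n) < ‖∑ k, a j k * ξ (k, l) ω‖} ⊆
      ⋃ p ∈ (Finset.univ : Finset (Fin n × Fin L)),
        {ω | Real.sqrt 2 * (ν * Real.sqrt (6 * Real.log n)) <
          ‖∑ k, a p.1 k * ξ (k, p.2) ω‖} := by
    rintro ω ⟨j, l, h⟩
    simp only [Set.mem_iUnion]
    refine ⟨(j, l), Finset.mem_univ _, ?_⟩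
    have : Real.sqrt (12 * Real.log n) = Real.sqrt 2 * Real.sqrt (6 * Real.log n) := by
      rw [← Real.sqrt_mul (by norm_num)]; ring_nf
    rw [this] at h
    simp only [Set.mem_ofPred_eq]
    linarith
  refine (measureReal_mono hsub (measure_ne_top P _)).trans ((measureReal_biUnion_finset_le _ _).trans
    ((Finset.sum_le_sum (g := fun _ => 4 * Real.exp (-(3 * Real.log n))) fun p _ => ?_).trans ?_))
  · have h := (hξ.precomp (f := fun k : Fin n => (k, p.2))
      (fun _ _ h => (Prod.mk.inj h).1)).measureReal_le_norm_sum_le hν (a p.1) (ha p.1)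
      (t := ν * Real.sqrt (6 * Real.log n)) (by positivity)
    refine h.trans (le_of_eq ?_)
    congr 2
    rw [mul_pow, Real.sq_sqrt (by positivity)]
    field_simp
    ring
  · have h4 : (4 * L : ℝ) ≤ n := by exact_mod_cast hn
    rw [Finset.sum_const, nsmul_eq_mul, Finset.card_univ, Fintype.card_prod, Fintype.card_fin,
      Fintype.card_fin, Real.exp_neg, show 3 * Real.log n = ((3 : ℕ) : ℝ) * Real.log n by norm_num,
      Real.exp_nat_mul, Real.exp_log hn0]
    push_cast
    rw [← sub_nonneg]
    have : 1 / (n : ℝ) - n * L * (4 * ((n : ℝ) ^ 3)⁻¹) = (n - 4 * L) / (n : ℝ) ^ 2 := by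
      field_simp
    rw [this]
    exact div_nonneg (by linarith) (by positivity)

end IsMaskFamily

end Tails

/-! ### Nuclear norms of matrices of rank at most two -/

section NuclearNorm

variable {n : ℕ}

lemma toEuclideanLin_outer_apply (u x v : EuclideanSpace ℂ (Fin n)) :
    Matrix.toEuclideanLin (outer u x) v = (∑ k, x k * v k) • u := by
  ext j
  simp [outer, Matrix.toLpLin_apply, Matrix.mulVec, dotProduct, Matrix.vecMulVec_apply,
    mul_comm, mul_assoc]
  rw [Finset.mul_sum]

/-- The right singular vectors of `X`: an orthonormal basis that `X` maps to an orthogonal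
family, the lengths of which are the singular values. -/
lemma exists_orthonormalBasis_nuclearNorm_eq (X : Matrix (Fin n) (Fin n) ℂ) :
    ∃ e : OrthonormalBasis (Fin n) ℂ (EuclideanSpace ℂ (Fin n)),
      (∀ i j, i ≠ j →
        inner ℂ (Matrix.toEuclideanLin X (e i)) (Matrix.toEuclideanLin X (e j)) = 0) ∧
      nuclearNorm X = ∑ i, ‖Matrix.toEuclideanLin X (e i)‖ := by
  set T := Matrix.toEuclideanLin X with hT
  have hn : Module.finrank ℂ (EuclideanSpace ℂ (Fin n)) = n := finrank_euclideanSpace_fin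
  have hs := T.isSymmetric_adjoint_comp_self
  have hinner : ∀ i j, inner ℂ (T (hs.eigenvectorBasis hn i)) (T (hs.eigenvectorBasis hn j)) =
      (hs.eigenvalues hn j : ℂ) * inner ℂ (hs.eigenvectorBasis hn i)
        (hs.eigenvectorBasis hn j) := fun i j => by
    rw [← LinearMap.adjoint_inner_right, ← LinearMap.comp_apply, hs.apply_eigenvectorBasis hn,
      inner_smul_right]
    rfl
  refine ⟨hs.eigenvectorBasis hn, fun i j hij => ?_, ?_⟩
  · rw [hinner, (hs.eigenvectorBasis hn).orthonormal.2 hij, mul_zero]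
  · refine Finset.sum_congr rfl fun i _ => ?_
    rw [← hT, T.singularValues_fin hn, Real.sqrt_eq_iff_mul_self_eq
      (T.isPositive_adjoint_comp_self.nonneg_eigenvalues hn i) (norm_nonneg _)]
    have h := hinner i i
    rw [inner_self_eq_norm_sq_to_K, inner_self_eq_norm_sq_to_K,
      (hs.eigenvectorBasis hn).orthonormal.1 i] at h
    simp only [Complex.coe_algebraMap, Complex.ofReal_one, one_pow, mul_one] at h
    rw [← sq]
    exact_mod_cast h.symm

lemma norm_toLp_star (x : EuclideanSpace ℂ (Fin n)) :
    ‖(WithLp.toLp 2 (star x.ofLp) : EuclideanSpace ℂ (Fin n))‖ = ‖x‖ := by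
  simp [EuclideanSpace.norm_eq]

lemma sum_mul_eq_inner (x v : EuclideanSpace ℂ (Fin n)) :
    ∑ k, x k * v k = inner ℂ (WithLp.toLp 2 (star x.ofLp) : EuclideanSpace ℂ (Fin n)) v := by
  simp [PiLp.inner_apply, mul_comm]

lemma nuclearNorm_outer_add_outer_le (a x b q : EuclideanSpace ℂ (Fin n)) :
    nuclearNorm (outer a x + outer b q) ≤ ‖a‖ * ‖x‖ + ‖b‖ * ‖q‖ := by
  classical
  obtain ⟨e, horth, hsum⟩ := exists_orthonormalBasis_nuclearNorm_eq (outer a x + outer b q)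
  set T := Matrix.toEuclideanLin (outer a x + outer b q) with hT
  let ι := {i : Fin n // T (e i) ≠ 0}
  -- The left singular vectors belonging to the non-zero singular values.
  let f : ι → EuclideanSpace ℂ (Fin n) := fun i => ((‖T (e i.1)‖⁻¹ : ℝ) : ℂ) • T (e i.1)
  have hf : Orthonormal ℂ f := by
    refine ⟨fun i => ?_, fun i j hij => ?_⟩
    · rw [norm_smul, Complex.norm_real, norm_inv, norm_norm,
        inv_mul_cancel₀ (norm_ne_zero_iff.2 i.2)]
    · change inner ℂ (f i) (f j) = 0
      rw [inner_smul_left, inner_smul_right, horth _ _ (fun h => hij (Subtype.ext h))]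
      simp
  have he : Orthonormal ℂ (fun i : ι => e i.1) :=
    e.orthonormal.comp _ Subtype.val_injective
  have hcs : ∀ c y : EuclideanSpace ℂ (Fin n),
      ∑ i : ι, ‖inner ℂ (f i) c‖ * ‖∑ k, y k * (e i.1) k‖ ≤ ‖c‖ * ‖y‖ := by
    intro c y
    refine (Real.sum_mul_le_sqrt_mul_sqrt _ _ _).trans ?_
    refine mul_le_mul (Real.sqrt_le_iff.2 ⟨norm_nonneg _, hf.sum_inner_products_le c⟩)
      (Real.sqrt_le_iff.2 ⟨norm_nonneg _, ?_⟩) (Real.sqrt_nonneg _) (norm_nonneg _)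
    rw [← norm_toLp_star y]
    refine le_trans (le_of_eq ?_) (he.sum_inner_products_le (s := Finset.univ) _)
    refine Finset.sum_congr rfl fun i _ => ?_
    rw [sum_mul_eq_inner, norm_inner_symm]
  have hterm : ∀ i : ι, ‖T (e i.1)‖ ≤ ‖inner ℂ (f i) a‖ * ‖∑ k, x k * (e i.1) k‖
      + ‖inner ℂ (f i) b‖ * ‖∑ k, q k * (e i.1) k‖ := by
    intro i
    have h0 : ‖T (e i.1)‖ ≠ 0 := norm_ne_zero_iff.2 i.2
    have h1 : inner ℂ (f i) (T (e i.1)) = (‖T (e i.1)‖ : ℂ) := by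
      rw [inner_smul_left, inner_self_eq_norm_sq_to_K]
      simp only [Complex.conj_ofReal, Complex.coe_algebraMap]
      rw [← Complex.ofReal_pow, ← Complex.ofReal_mul]
      congr 1
      field_simp
    have h2 : T (e i.1) = (∑ k, x k * (e i.1) k) • a + (∑ k, q k * (e i.1) k) • b := by
      rw [← toEuclideanLin_outer_apply, ← toEuclideanLin_outer_apply, ← LinearMap.add_apply,
        ← map_add]
    have h3 : ‖T (e i.1)‖ = ‖inner ℂ (f i) (T (e i.1))‖ := by
      rw [h1, Complex.norm_real, norm_norm]
    rw [h3]
    conv_lhs => rw [h2]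
    rw [inner_add_right, inner_smul_right, inner_smul_right]
    refine (norm_add_le _ _).trans (le_of_eq ?_)
    rw [norm_mul, norm_mul]
    ring
  have hsub : ∑ i, ‖T (e i)‖ = ∑ i : ι, ‖T (e i.1)‖ := by
    rw [← Finset.sum_filter_of_ne (p := fun i => T (e i) ≠ 0) fun i _ h => by simpa using h]
    exact Finset.sum_subtype _ (by simp) _
  rw [hsum, hsub]
  refine (Finset.sum_le_sum fun i _ => hterm i).trans ?_
  rw [Finset.sum_add_distrib]
  exact add_le_add (hcs a x) (hcs b q)

/-- For a unit vector `y` and an orthonormal basis, `∑ |⟨e_i, y⟩| ≥ ∑ |⟨e_i, y⟩|² = 1`. -/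
lemma one_le_nuclearNorm_outer {u x : EuclideanSpace ℂ (Fin n)} (hu : ‖u‖ = 1) (hx : ‖x‖ = 1) :
    1 ≤ nuclearNorm (outer u x) := by
  obtain ⟨e, -, hsum⟩ := exists_orthonormalBasis_nuclearNorm_eq (outer u x)
  rw [hsum]
  set y : EuclideanSpace ℂ (Fin n) := WithLp.toLp 2 (star x.ofLp)
  have hy : ‖y‖ = 1 := by rw [norm_toLp_star, hx]
  have h1 : ∑ i, ‖inner ℂ (e i) y‖ ^ 2 = 1 := by rw [e.sum_sq_norm_inner_right, hy, one_pow]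
  rw [← h1]
  refine Finset.sum_le_sum fun i _ => ?_
  rw [toEuclideanLin_outer_apply, norm_smul, hu, mul_one, sum_mul_eq_inner]
  change _ ≤ ‖inner ℂ y (e i)‖
  rw [norm_inner_symm y]
  have : ‖inner ℂ (e i) y‖ ≤ 1 := by
    refine (norm_inner_le_norm _ _).trans ?_
    rw [e.orthonormal.1 i, hy, one_mul]
  nlinarith [norm_nonneg (inner ℂ (e i) y)]

end NuclearNorm

/-! ### The discrete Fourier transform -/

section DFT

variable {n : ℕ}

lemma dftMatrix_apply (j k : Fin n) : dftMatrix n j k =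
    Complex.exp (-(2 * Real.pi * Complex.I * (j : ℕ) * (k : ℕ)) / n) := rfl

lemma norm_dftMatrix (j k : Fin n) : ‖dftMatrix n j k‖ = 1 := by
  rw [dftMatrix_apply, show -(2 * Real.pi * Complex.I * (j : ℕ) * (k : ℕ)) / (n : ℂ) =
    ((-(2 * Real.pi * (j : ℕ) * (k : ℕ)) / n : ℝ) : ℂ) * Complex.I by push_cast; ring,
    Complex.norm_exp_ofReal_mul_I]

lemma conj_dftMatrix_mul_self (j k : Fin n) :
    (starRingEnd ℂ) (dftMatrix n j k) * dftMatrix n j k = 1 := by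
  rw [mul_comm, Complex.mul_conj, Complex.normSq_eq_norm_sq, norm_dftMatrix]
  simp

lemma sum_conj_dftMatrix_mul (k k' : Fin n) :
    ∑ j, (starRingEnd ℂ) (dftMatrix n j k) * dftMatrix n j k' = if k = k' then (n : ℂ) else 0 := by
  split_ifs with h
  · subst h
    simp [conj_dftMatrix_mul_self]
  · have hn : n ≠ 0 := by rintro rfl; exact k.elim0
    have hn' : (n : ℂ) ≠ 0 := by exact_mod_cast hn
    set ζ : ℂ := Complex.exp (2 * Real.pi * Complex.I * (((k : ℕ) : ℂ) - ((k' : ℕ) : ℂ)) / n)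
      with hζ
    have hterm : ∀ j : Fin n,
        (starRingEnd ℂ) (dftMatrix n j k) * dftMatrix n j k' = ζ ^ (j : ℕ) := by
      intro j
      rw [dftMatrix_apply, dftMatrix_apply, ← Complex.exp_conj, ← Complex.exp_add, hζ,
        ← Complex.exp_nat_mul]
      congr 1
      simp [map_ofNat]
      ring
    simp_rw [hterm]
    have hpow : ζ ^ n = 1 := by
      rw [hζ, ← Complex.exp_nat_mul, Complex.exp_eq_one_iff]
      refine ⟨(k : ℤ) - (k' : ℤ), ?_⟩
      push_cast
      field_simp
    have hne : ζ ≠ 1 := by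
      intro h1
      rw [hζ, Complex.exp_eq_one_iff] at h1
      obtain ⟨m, hm⟩ := h1
      have hpi : (2 * Real.pi * Complex.I : ℂ) ≠ 0 := Complex.two_pi_I_ne_zero
      have h2 : (((k : ℕ) : ℂ) - ((k' : ℕ) : ℂ)) = m * n := by
        field_simp at hm
        have h3 : (2 * Real.pi * Complex.I : ℂ) * (((k : ℕ) : ℂ) - ((k' : ℕ) : ℂ))
            = (2 * Real.pi * Complex.I : ℂ) * (m * n) := by
          linear_combination (2 * Real.pi * Complex.I : ℂ) * hm
        exact mul_left_cancel₀ hpi h3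
      have h4 : ((k : ℕ) : ℤ) - ((k' : ℕ) : ℤ) = m * n := by exact_mod_cast h2
      have hk := k.2
      have hk' := k'.2
      have : m = 0 := by
        by_contra hm0
        have : (1 : ℤ) ≤ |m| := Int.one_le_abs hm0
        have h5 : |((k : ℕ) : ℤ) - ((k' : ℕ) : ℤ)| < n := by rw [abs_lt]; omega
        rw [h4, abs_mul, Nat.abs_cast] at h5
        nlinarith
      rw [this, zero_mul, sub_eq_zero] at h4
      exact h (Fin.ext (by exact_mod_cast h4))
    have := geom_sum_eq hne n
    rw [hpow, sub_self, zero_div] at this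
    rwa [← Fin.sum_univ_eq_sum_range] at this

/-- Parseval's identity for the unnormalised DFT matrix. -/
lemma sum_norm_dftMatrix_sum_sq (c : Fin n → ℂ) :
    ∑ j, ‖∑ k, dftMatrix n j k * c k‖ ^ 2 = n * ∑ k, ‖c k‖ ^ 2 := by
  have hsq : ∀ z : ℂ, ((‖z‖ ^ 2 : ℝ) : ℂ) = (starRingEnd ℂ) z * z := fun z => by
    rw [mul_comm, Complex.mul_conj, Complex.normSq_eq_norm_sq]
  rw [← Complex.ofReal_inj]
  push_cast
  simp_rw [← Complex.ofReal_pow, hsq, map_sum, map_mul, Finset.sum_mul_sum]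
  rw [Finset.sum_comm, Finset.mul_sum]
  refine Finset.sum_congr rfl fun k _ => ?_
  rw [Finset.sum_comm]
  have : ∀ k', ∑ j, (starRingEnd ℂ) (dftMatrix n j k) * (starRingEnd ℂ) (c k)
      * (dftMatrix n j k' * c k') = if k = k' then (n : ℂ) * ((starRingEnd ℂ) (c k) * c k') else 0 := by
    intro k'
    have h := congrArg (· * ((starRingEnd ℂ) (c k) * c k')) (sum_conj_dftMatrix_mul k k')
    simp only [Finset.sum_mul, ite_mul, zero_mul] at h
    rw [← h]
    exact Finset.sum_congr rfl fun j _ => by ring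
  simp [this]

lemma norm_dft_sq (h : EuclideanSpace ℂ (Fin n)) : ‖dft h‖ ^ 2 = n * ‖h‖ ^ 2 := by
  rw [EuclideanSpace.norm_sq_eq, EuclideanSpace.norm_sq_eq, ← sum_norm_dftMatrix_sum_sq]
  rfl

end DFT

/-! ### A row with a short correction -/

section RowCorrection

variable {n L : ℕ}

lemma toEuclideanLin_map_star_apply (D : Matrix (Fin n) (Fin L) ℂ) (z : EuclideanSpace ℂ (Fin L))
    (k : Fin n) : Matrix.toEuclideanLin (D.map star) z k = ∑ l, (starRingEnd ℂ) (D k l) * z l := by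
  simp [Matrix.toLpLin_apply, Matrix.mulVec, dotProduct]

lemma norm_toEuclideanLin_map_star (D : Matrix (Fin n) (Fin L) ℂ)
    (z : EuclideanSpace ℂ (Fin L)) :
    ‖Matrix.toEuclideanLin (D.map star) z‖ =
      ‖Matrix.toEuclideanLin D (WithLp.toLp 2 (star z.ofLp))‖ := by
  rw [EuclideanSpace.norm_eq, EuclideanSpace.norm_eq]
  congr 1
  refine Finset.sum_congr rfl fun k _ => ?_
  rw [toEuclideanLin_map_star_apply, ← Complex.norm_conj]
  simp [Matrix.toLpLin_apply, Matrix.mulVec, dotProduct]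

/-- If all singular values of `D` are at least `√n / 4`, the orthogonal projection onto the range
of the entrywise conjugate of `D` has small diagonal entries. -/
lemma norm_starProjection_single_sq_le {D : Matrix (Fin n) (Fin L) ℂ} {ν : ℝ} (hν : 0 ≤ ν)
    (hn : 0 < n) (hD : ∀ k l, ‖D k l‖ ≤ ν)
    (hσ : ∀ z, Real.sqrt n / 4 * ‖z‖ ≤ ‖Matrix.toEuclideanLin D z‖) (k : Fin n) :
    ‖(LinearMap.range (Matrix.toEuclideanLin (D.map star))).starProjection
      (EuclideanSpace.single k 1)‖ ^ 2 ≤ 16 * ν ^ 2 * L / n := by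
  set R := LinearMap.range (Matrix.toEuclideanLin (D.map star))
  set v := R.starProjection (EuclideanSpace.single k 1) with hv
  have hn' : (0 : ℝ) < n := by exact_mod_cast hn
  obtain ⟨z, hz⟩ : v ∈ R := R.starProjection_apply_mem _
  have h1 : ‖v‖ ^ 2 = ‖v k‖ := by
    have h : inner ℂ v v = v k := by
      conv_lhs => rw [hv]
      rw [Submodule.inner_starProjection_left_eq_right, R.starProjection_eq_self_iff.2 ⟨z, hz⟩,
        EuclideanSpace.inner_single_left]
      simp
    rw [← h, inner_self_eq_norm_sq_to_K]
    simp
  have h2 : ‖v k‖ ≤ ν * (Real.sqrt L * ‖z‖) := by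
    rw [← hz, toEuclideanLin_map_star_apply]
    refine (norm_sum_le _ _).trans ?_
    refine (Finset.sum_le_sum (g := fun l => ν * ‖z l‖) fun l _ => ?_).trans ?_
    · rw [norm_mul, Complex.norm_conj]
      exact mul_le_mul_of_nonneg_right (hD k l) (norm_nonneg _)
    · rw [← Finset.mul_sum]
      refine mul_le_mul_of_nonneg_left ?_ hν
      have h := Real.sum_mul_le_sqrt_mul_sqrt Finset.univ (fun _ : Fin L => (1 : ℝ)) fun l => ‖z l‖
      simpa [EuclideanSpace.norm_eq] using h
  have h3 : Real.sqrt n / 4 * ‖z‖ ≤ ‖v‖ := by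
    have := hσ (WithLp.toLp 2 (star z.ofLp))
    rwa [← norm_toEuclideanLin_map_star, hz, norm_toLp_star] at this
  have h4 : ‖v‖ ^ 2 * Real.sqrt n ≤ 4 * ν * Real.sqrt L * ‖v‖ := by
    have hs : 0 ≤ ν * Real.sqrt L := by positivity
    have := Real.sqrt_nonneg (n : ℝ)
    rw [h1]
    calc ‖v k‖ * Real.sqrt n ≤ ν * (Real.sqrt L * ‖z‖) * Real.sqrt n := by gcongr
      _ = 4 * (ν * Real.sqrt L) * (Real.sqrt n / 4 * ‖z‖) := by ring
      _ ≤ 4 * (ν * Real.sqrt L) * ‖v‖ := by gcongr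
      _ = _ := by ring
  have h5 : ‖v‖ * Real.sqrt n ≤ 4 * ν * Real.sqrt L := by
    rcases (norm_nonneg v).eq_or_lt with h | h
    · rw [← h, zero_mul]; positivity
    · nlinarith
  have h6 := pow_le_pow_left₀ (by positivity) h5 2
  rw [mul_pow, mul_pow, mul_pow, Real.sq_sqrt hn'.le, Real.sq_sqrt (Nat.cast_nonneg _)] at h6
  rw [le_div_iff₀ hn']
  linarith

/-- There is a row `j` in which `u` is small and whose measurements of `x` are reproduced by a
short vector `q`.  By Parseval's identity, the projections of the rows `F_j ⊙ x` onto the range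
of the conjugated masks have total squared length at most `16 ν² L`, so the best row does it. -/
lemma exists_row_correction {D : Matrix (Fin n) (Fin L) ℂ} {ν : ℝ} (hν : 0 ≤ ν)
    (hn : 0 < n) (hD : ∀ k l, ‖D k l‖ ≤ ν)
    (hσ : ∀ z, Real.sqrt n / 4 * ‖z‖ ≤ ‖Matrix.toEuclideanLin D z‖)
    {u x : EuclideanSpace ℂ (Fin n)} (hu : ‖u‖ = 1) (hx : ‖x‖ = 1) :
    ∃ (j : Fin n) (q : EuclideanSpace ℂ (Fin n)),
      (∀ l, ∑ k, dftMatrix n j k * q k * D k l = ∑ k, dftMatrix n j k * x k * D k l) ∧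
      ‖u j‖ ^ 2 + ‖q‖ ^ 2 ≤ (1 + 16 * ν ^ 2 * L) / n := by
  have hn' : (0 : ℝ) < n := by exact_mod_cast hn
  set R := LinearMap.range (Matrix.toEuclideanLin (D.map star)) with hR
  let e : Fin n → EuclideanSpace ℂ (Fin n) := fun i => EuclideanSpace.single i 1
  let w : Fin n → EuclideanSpace ℂ (Fin n) := fun j =>
    WithLp.toLp 2 fun k => dftMatrix n j k * x k
  have hcoord : ∀ (v : EuclideanSpace ℂ (Fin n)) i, v i = inner ℂ (e i) v := fun v i => by
    rw [EuclideanSpace.inner_single_left]; simp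
  have hsymm : ∀ i k, ‖(R.starProjection (e i)) k‖ = ‖(R.starProjection (e k)) i‖ := fun i k => by
    rw [hcoord, hcoord _ i, ← Submodule.inner_starProjection_left_eq_right, norm_inner_symm]
  have hPw : ∀ j i, (R.starProjection (w j)) i =
      ∑ k, dftMatrix n j k * ((starRingEnd ℂ) ((R.starProjection (e i)) k) * x k) := fun j i => by
    rw [hcoord, ← Submodule.inner_starProjection_left_eq_right, PiLp.inner_apply]
    refine Finset.sum_congr rfl fun k _ => ?_
    simp only [w, RCLike.inner_apply]
    ring
  have hsum : ∑ j, ‖R.starProjection (w j)‖ ^ 2 ≤ 16 * ν ^ 2 * L := by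
    simp_rw [EuclideanSpace.norm_sq_eq, hPw]
    rw [Finset.sum_comm]
    simp_rw [sum_norm_dftMatrix_sum_sq, norm_mul, Complex.norm_conj, mul_pow]
    rw [← Finset.mul_sum, Finset.sum_comm]
    have hcol : ∀ k, ∑ i, ‖(R.starProjection (e i)) k‖ ^ 2 * ‖x k‖ ^ 2 =
        ‖R.starProjection (e k)‖ ^ 2 * ‖x k‖ ^ 2 := fun k => by
      rw [← Finset.sum_mul, EuclideanSpace.norm_sq_eq]
      exact congrArg (· * _) (Finset.sum_congr rfl fun i _ => by rw [hsymm])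
    simp_rw [hcol]
    have : ∑ k, ‖R.starProjection (e k)‖ ^ 2 * ‖x k‖ ^ 2 ≤ 16 * ν ^ 2 * L / n := by
      refine (Finset.sum_le_sum fun k _ => mul_le_mul_of_nonneg_right
        (norm_starProjection_single_sq_le hν hn hD hσ k) (sq_nonneg _)).trans ?_
      rw [← Finset.mul_sum, ← EuclideanSpace.norm_sq_eq, hx]
      simp
    refine (mul_le_mul_of_nonneg_left this hn'.le).trans (le_of_eq ?_)
    field_simp
  have : Nonempty (Fin n) := ⟨⟨0, hn⟩⟩
  obtain ⟨j, -, hj⟩ := Finset.exists_le_of_sum_le (s := (Finset.univ : Finset (Fin n)))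
    (f := fun j => ‖u j‖ ^ 2 + ‖R.starProjection (w j)‖ ^ 2)
    (g := fun _ => (1 + 16 * ν ^ 2 * L) / n) Finset.univ_nonempty (by
      rw [Finset.sum_add_distrib, ← EuclideanSpace.norm_sq_eq, hu, Finset.sum_const,
        Finset.card_univ, Fintype.card_fin, nsmul_eq_mul, mul_div_cancel₀ _ hn'.ne']
      linarith)
  refine ⟨j, WithLp.toLp 2 fun k => (starRingEnd ℂ) (dftMatrix n j k) *
    (R.starProjection (w j)) k, fun l => ?_, ?_⟩
  · -- The part of `w j` orthogonal to the range is not seen by the masks.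
    have h := R.starProjection_inner_eq_zero (w j)
      (Matrix.toEuclideanLin (D.map star) (EuclideanSpace.single l 1)) ⟨_, rfl⟩
    rw [← inner_conj_symm, map_eq_zero, PiLp.inner_apply] at h
    simp only [toEuclideanLin_map_star_apply, RCLike.inner_apply, PiLp.sub_apply,
      PiLp.single_apply, mul_ite, mul_one, mul_zero, Finset.sum_ite_eq', Finset.mem_univ, if_true,
      Complex.conj_conj, sub_mul, Finset.sum_sub_distrib, sub_eq_zero] at h
    refine Eq.trans ?_ h.symm
    refine Finset.sum_congr rfl fun k _ => ?_
    linear_combination (R.starProjection (w j)) k * D k l * conj_dftMatrix_mul_self j k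
  · convert! hj using 2
    rw [EuclideanSpace.norm_sq_eq, EuclideanSpace.norm_sq_eq]
    simp [norm_dftMatrix]

end RowCorrection

/-! ### A direction of descent of the nuclear norm -/

section Descent

variable {n L : ℕ}

/-- Replacing `u xᵀ` by `u xᵀ + t (e_j (x - q)ᵀ - β u xᵀ)` does not increase the nuclear norm if
`β` exceeds `|u_j| + ‖q‖` and `t` is small. -/
lemma nuclearNorm_descent_le {u x q : EuclideanSpace ℂ (Fin n)} (hu : ‖u‖ = 1) (hx : ‖x‖ = 1)
    (j : Fin n) {β t : ℝ} (hβ : β ≤ 1) (ht : 0 ≤ t) (htβ : t ≤ β - ‖u j‖ - ‖q‖) :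
    nuclearNorm (outer u x + (t : ℂ) • (outer (EuclideanSpace.single j 1) (x - q)
      - (β : ℂ) • outer u x)) ≤ nuclearNorm (outer u x) := by
  set e : EuclideanSpace ℂ (Fin n) := EuclideanSpace.single j 1 with he
  have hX : outer u x + (t : ℂ) • (outer e (x - q) - (β : ℂ) • outer u x) =
      outer (((1 - t * β : ℝ) : ℂ) • u + (t : ℂ) • e) x + outer ((-t : ℂ) • e) q := by
    ext a b
    simp [outer, Matrix.vecMulVec_apply]
    ring
  rw [hX]
  refine (nuclearNorm_outer_add_outer_le _ _ _ _).trans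
    (le_trans ?_ (one_le_nuclearNorm_outer hu hx))
  have hq := norm_nonneg q
  have huj := norm_nonneg (u j)
  have he1 : ‖e‖ = 1 := by simp [he]
  have h1 : ‖((1 - t * β : ℝ) : ℂ) • u + (t : ℂ) • e‖ ≤ 1 - t * ‖q‖ := by
    refine le_of_sq_le_sq ?_ (by nlinarith)
    rw [norm_add_sq (𝕜 := ℂ), norm_smul, norm_smul, hu, he1, inner_smul_left, inner_smul_right,
      ← inner_conj_symm, he, EuclideanSpace.inner_single_left]
    simp only [Complex.norm_real, Real.norm_eq_abs, mul_one, sq_abs, Complex.conj_ofReal, map_one,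
      one_mul, RCLike.re_to_complex]
    rw [Complex.re_ofReal_mul, Complex.re_ofReal_mul, Complex.conj_re]
    have hre : (u j).re ≤ ‖u j‖ := Complex.re_le_norm _
    have h0 : 0 ≤ t * (1 - t * β) := mul_nonneg ht (by nlinarith)
    have h2 : (1 - t * β) * (t * (u j).re) ≤ t * (1 - t * β) * ‖u j‖ := by nlinarith
    have h3 : t * (t * β) * ‖u j‖ ≥ 0 := by
      have : 0 ≤ β := by linarith
      positivity
    have h4 : t ^ 2 * β ^ 2 ≤ t ^ 2 := by
      have : β ^ 2 ≤ 1 := by nlinarith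
      nlinarith [sq_nonneg t]
    have h5 : t * t ≤ t * (β - ‖u j‖ - ‖q‖) := mul_le_mul_of_nonneg_left htβ ht
    nlinarith [sq_nonneg (t * ‖q‖)]
  have h2 : ‖(-t : ℂ) • e‖ = t := by
    rw [norm_smul, he1, norm_neg, Complex.norm_real, Real.norm_of_nonneg ht, mul_one]
  rw [h2, hx]
  linarith

end Descent

/-! ### The measurement operator on rank-one matrices -/

section Measurement

variable {n L : ℕ}

lemma measurement_apply (D : Matrix (Fin n) (Fin L) ℂ) (X : Matrix (Fin n) (Fin n) ℂ)
    (j : Fin n) (l : Fin L) : measurement D X j l =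
      ((1 / Real.sqrt L : ℝ) : ℂ) * ∑ k, dftMatrix n j k * X j k * D k l := by
  rw [measurement, Matrix.smul_apply, Matrix.mul_apply, smul_eq_mul]
  rfl

lemma measurement_add (D : Matrix (Fin n) (Fin L) ℂ) (X Y : Matrix (Fin n) (Fin n) ℂ) :
    measurement D (X + Y) = measurement D X + measurement D Y := by
  rw [measurement, Matrix.hadamard_add, Matrix.add_mul, smul_add]; rfl

lemma measurement_smul (D : Matrix (Fin n) (Fin L) ℂ) (c : ℂ) (X : Matrix (Fin n) (Fin n) ℂ) :
    measurement D (c • X) = c • measurement D X := by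
  rw [measurement, measurement, Matrix.hadamard_smul, Matrix.smul_mul, smul_comm]

lemma measurement_sub (D : Matrix (Fin n) (Fin L) ℂ) (X Y : Matrix (Fin n) (Fin n) ℂ) :
    measurement D (X - Y) = measurement D X - measurement D Y := by
  have := measurement_add D (X - Y) Y
  rw [sub_add_cancel] at this
  rw [this, add_sub_cancel_right]

lemma measurement_outer_apply (D : Matrix (Fin n) (Fin L) ℂ) (v w : EuclideanSpace ℂ (Fin n))
    (j : Fin n) (l : Fin L) : measurement D (outer v w) j l =
      ((1 / Real.sqrt L : ℝ) : ℂ) * (v j * ∑ k, dftMatrix n j k * w k * D k l) := by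
  rw [measurement_apply]
  congr 1
  rw [Finset.mul_sum]
  refine Finset.sum_congr rfl fun k _ => ?_
  simp only [outer, Matrix.vecMulVec_apply]
  ring

lemma outer_sub (v w w' : EuclideanSpace ℂ (Fin n)) :
    outer v (w - w') = outer v w - outer v w' := by
  ext a b
  simp [outer, Matrix.vecMulVec_apply, mul_sub]

lemma outer_smul (c : ℂ) (v w : EuclideanSpace ℂ (Fin n)) : outer v (c • w) = c • outer v w := by
  ext a b
  simp [outer, Matrix.vecMulVec_apply]
  ring

lemma frobenius_norm_sq {m p : ℕ} (A : Matrix (Fin m) (Fin p) ℂ) :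
    ‖A‖ ^ 2 = ∑ i, ∑ j, ‖A i j‖ ^ 2 := by
  rw [Matrix.frobenius_norm_def, ← Real.sqrt_eq_rpow, Real.sq_sqrt (by positivity)]
  simp

lemma norm_outer (v w : EuclideanSpace ℂ (Fin n)) : ‖outer v w‖ = ‖v‖ * ‖w‖ := by
  rw [← sq_eq_sq₀ (norm_nonneg _) (by positivity), frobenius_norm_sq, mul_pow,
    EuclideanSpace.norm_sq_eq, EuclideanSpace.norm_sq_eq, Finset.sum_mul_sum]
  simp [outer, Matrix.vecMulVec_apply, mul_pow]

lemma norm_measurement_outer_le {D : Matrix (Fin n) (Fin L) ℂ} (hL : 1 ≤ L)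
    {u x : EuclideanSpace ℂ (Fin n)} (hu : ‖u‖ = 1) {K : ℝ} (hK : 0 ≤ K)
    (hS : ∀ j l, ‖∑ k, dftMatrix n j k * x k * D k l‖ ≤ K) :
    ‖measurement D (outer u x)‖ ≤ K := by
  have hL' : (0 : ℝ) < L := by exact_mod_cast hL
  refine le_of_sq_le_sq ?_ hK
  rw [frobenius_norm_sq]
  have : ∀ j l, ‖measurement D (outer u x) j l‖ ^ 2 ≤ 1 / L * (‖u j‖ ^ 2 * K ^ 2) := fun j l => by
    rw [measurement_outer_apply, norm_mul, norm_mul, mul_pow, mul_pow, Complex.norm_real,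
      Real.norm_eq_abs, sq_abs, div_pow, one_pow, Real.sq_sqrt hL'.le]
    gcongr
    exact hS j l
  refine (Finset.sum_le_sum fun j _ => Finset.sum_le_sum fun l _ => this j l).trans ?_
  simp only [Finset.sum_const, Finset.card_univ, Fintype.card_fin, nsmul_eq_mul]
  rw [← Finset.mul_sum, ← Finset.mul_sum, ← Finset.sum_mul, ← EuclideanSpace.norm_sq_eq, hu]
  field_simp
  simp

end Measurement

/-! ### Instability for a well-conditioned mask matrix -/

section Instability

variable {n L : ℕ}

/-- If `B` is zero, a small rank-one matrix in row `j` has non-zero measurements, which keep the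
sum non-zero and of size at most `M`; otherwise the zero perturbation will do. -/
lemma exists_perturbation {D : Matrix (Fin n) (Fin L) ℂ} (hL : 1 ≤ L) (hn : 0 < n)
    (hσ : ∀ z, Real.sqrt n / 4 * ‖z‖ ≤ ‖Matrix.toEuclideanLin D z‖) (j : Fin n)
    (B : Matrix (Fin n) (Fin L) ℂ) {M ε : ℝ} (hM : 0 < M) (hB : ‖B‖ ≤ M) (hε : 0 < ε) :
    ∃ p : EuclideanSpace ℂ (Fin n), ‖p‖ ≤ ε ∧
      B + measurement D (outer (EuclideanSpace.single j 1) p) ≠ 0 ∧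
      ‖B + measurement D (outer (EuclideanSpace.single j 1) p)‖ ≤ M := by
  by_cases h0 : B = 0
  · set l : Fin L := ⟨0, hL⟩
    -- `p` is a multiple of `conj F_j ⊙ conj d_l`, which the mask `d_l` sees.
    let r : EuclideanSpace ℂ (Fin n) := WithLp.toLp 2 fun k =>
      (starRingEnd ℂ) (dftMatrix n j k) * (starRingEnd ℂ) (D k l)
    set A := measurement D (outer (EuclideanSpace.single j 1) r) with hA
    have hA0 : A ≠ 0 := by
      intro hzero
      have h1 := congrFun (congrFun hzero j) l
      have h2 : ∑ k, dftMatrix n j k * r k * D k l = ((∑ k, ‖D k l‖ ^ 2 : ℝ) : ℂ) := by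
        push_cast
        refine Finset.sum_congr rfl fun k _ => ?_
        have h3 : (starRingEnd ℂ) (D k l) * D k l = (‖D k l‖ : ℂ) ^ 2 := by
          rw [mul_comm, Complex.mul_conj, Complex.normSq_eq_norm_sq]; push_cast; rfl
        simp only [r]
        linear_combination (starRingEnd ℂ) (D k l) * D k l * conj_dftMatrix_mul_self j k + h3
      rw [hA, measurement_outer_apply, h2] at h1
      have hL' : (0 : ℝ) < L := by exact_mod_cast hL
      have hn' : (0 : ℝ) < n := by exact_mod_cast hn
      have hsqrt := Real.sqrt_pos.2 hL'
      have h4 : ∑ k, ‖D k l‖ ^ 2 = 0 := by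
        simpa [hsqrt.ne', hL'.ne', Complex.ofReal_eq_zero, -Complex.ofReal_sum,
          (show L ≠ 0 by omega)] using h1
      have h5 := hσ (EuclideanSpace.single l 1)
      have h6 : ‖Matrix.toEuclideanLin D (EuclideanSpace.single l 1)‖ ^ 2 = 0 := by
        rw [EuclideanSpace.norm_sq_eq, ← h4]
        refine Finset.sum_congr rfl fun k _ => ?_
        simp [Matrix.toLpLin_apply]
      rw [pow_eq_zero_iff two_ne_zero] at h6
      rw [h6] at h5
      simp at h5
      have := Real.sqrt_pos.2 hn'
      linarith
    have hApos : 0 < ‖A‖ := norm_pos_iff.2 hA0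
    have hr := norm_nonneg r
    set δ : ℝ := min (M / ‖A‖) (ε / (‖r‖ + 1)) with hδ
    have hδ0 : 0 < δ := lt_min (by positivity) (by positivity)
    have hδ1 : δ * ‖A‖ ≤ M := by
      rw [← le_div_iff₀ hApos]; exact min_le_left _ _
    have hδ2 : δ * (‖r‖ + 1) ≤ ε := by
      rw [← le_div_iff₀ (by positivity)]; exact min_le_right _ _
    have hδn : ‖(δ : ℂ)‖ = δ := by rw [Complex.norm_real, Real.norm_of_nonneg hδ0.le]
    refine ⟨(δ : ℂ) • r, ?_, ?_, ?_⟩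
    · rw [norm_smul, hδn]; nlinarith
    · rw [outer_smul, measurement_smul, h0, zero_add]
      exact smul_ne_zero (by exact_mod_cast hδ0.ne') hA0
    · rw [outer_smul, measurement_smul, h0, zero_add, norm_smul, hδn]
      exact hδ1
  · have h1 : measurement D (outer (EuclideanSpace.single j 1) 0) = 0 := by
      ext a b
      simp [measurement_outer_apply]
    exact ⟨0, by simpa using hε.le, by rwa [h1, add_zero], by rwa [h1, add_zero]⟩

/-- Instability for a fixed mask matrix that is well conditioned and has bounded transformed
measurements of `x`. -/
lemma exists_noise_solution {D : Matrix (Fin n) (Fin L) ℂ} {ν : ℝ} (hν : 1 ≤ ν) (hL : 1 ≤ L)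
    (hn : 160 * (ν ^ 2 * L) ≤ n) (hD : ∀ k l, ‖D k l‖ ≤ ν)
    (hσ : ∀ z, Real.sqrt n / 4 * ‖z‖ ≤ ‖Matrix.toEuclideanLin D z‖)
    {u x : EuclideanSpace ℂ (Fin n)} (hu : ‖u‖ = 1) (hx : ‖x‖ = 1) {K : ℝ} (hK : 0 < K)
    (hS : ∀ j l, ‖∑ k, dftMatrix n j k * x k * D k l‖ ≤ K) :
    ∃ (Z : Matrix (Fin n) (Fin L) ℂ) (X : Matrix (Fin n) (Fin n) ℂ), Z ≠ 0 ∧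
      IsConstrainedLSSolution D (measurement D (outer u x) + Z) (nuclearNorm (outer u x)) X ∧
      ‖Z‖ ≤ 50 * ν * Real.sqrt (L / n) * K * ‖X - outer u x‖ := by
  have hL' : (1 : ℝ) ≤ L := by exact_mod_cast hL
  have hν2 : 1 ≤ ν ^ 2 := one_le_pow₀ hν
  have hνL : 1 ≤ ν ^ 2 * L := by nlinarith
  have hn0 : (0 : ℝ) < n := by linarith
  have hn1 : 0 < n := by exact_mod_cast hn0
  obtain ⟨j, q, hq, hjq⟩ := exists_row_correction (by linarith) hn1 hD hσ hu hx
  set b := Real.sqrt (17 * (ν ^ 2 * L) / n) with hb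
  have hb2 : b ^ 2 = 17 * (ν ^ 2 * L) / n := Real.sq_sqrt (by positivity)
  have hb0 : 0 < b := Real.sqrt_pos.2 (by positivity)
  have hjq' : ‖u j‖ ^ 2 + ‖q‖ ^ 2 ≤ b ^ 2 := by
    rw [hb2]
    refine hjq.trans ?_
    gcongr
    nlinarith
  have hb1 : b ^ 2 ≤ 17 / 160 := by
    rw [hb2, div_le_div_iff₀ hn0 (by norm_num)]; linarith
  have hb3 : b ≤ 33 / 100 := by nlinarith
  have hqb : ‖q‖ ≤ b := by nlinarith [sq_nonneg ‖u j‖, norm_nonneg q]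
  have hujq : ‖u j‖ + ‖q‖ ≤ 142 / 100 * b := by
    refine le_of_sq_le_sq ?_ (by positivity)
    nlinarith [sq_nonneg (‖u j‖ - ‖q‖)]
  set β := 3 / 2 * b with hβ
  have hβ0 : 0 < β := by positivity
  have hβn : ‖(β : ℂ)‖ = β := by rw [Complex.norm_real, Real.norm_of_nonneg hβ0.le]
  obtain ⟨p, hp, hp0, hpK⟩ := exists_perturbation hL hn1 hσ j
    (-((β : ℂ) • measurement D (outer u x))) (M := β * K) (ε := b / 25) (by positivity) (by
      rw [norm_neg, norm_smul, hβn]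
      gcongr
      exact norm_measurement_outer_le hL hu hK.le hS) (by positivity)
  -- With this sign, subtracting `e_j q'ᵀ` adds the measurements of `e_j pᵀ`.
  set q' := q - p with hq'
  have hq'q : ‖q'‖ ≤ ‖q‖ + b / 25 := (norm_sub_le _ _).trans (by linarith)
  set t := β - ‖u j‖ - ‖q'‖ with ht
  have ht0 : 0 < t := by rw [ht]; linarith
  set e : EuclideanSpace ℂ (Fin n) := EuclideanSpace.single j 1 with he
  have he1 : ‖e‖ = 1 := by simp [he]
  set W := outer e (x - q') - (β : ℂ) • outer u x with hW
  have hAxq : measurement D (outer e x) = measurement D (outer e q) := by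
    ext a l
    rw [measurement_outer_apply, measurement_outer_apply]
    by_cases haj : a = j
    · rw [haj, hq]
    · simp [he, haj]
  have hAW : measurement D W =
      -((β : ℂ) • measurement D (outer u x)) + measurement D (outer e p) := by
    rw [hW, hq', measurement_sub, measurement_smul, outer_sub, outer_sub, measurement_sub,
      measurement_sub, hAxq]
    abel
  have hWn : 1 / 8 ≤ ‖W‖ := by
    have h1 : ‖outer e (x - q')‖ = ‖x - q'‖ := by rw [norm_outer, he1, one_mul]
    have h2 : ‖(β : ℂ) • outer u x‖ = β := by
      rw [norm_smul, norm_outer, hu, hx, hβn]; ring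
    have h3 := norm_sub_norm_le (outer e (x - q')) ((β : ℂ) • outer u x)
    have h4 := norm_sub_norm_le x q'
    rw [h1, h2] at h3
    rw [hx] at h4
    rw [hW]
    linarith
  have htn : ‖(t : ℂ)‖ = t := by rw [Complex.norm_real, Real.norm_of_nonneg ht0.le]
  refine ⟨(t : ℂ) • measurement D W, outer u x + (t : ℂ) • W, ?_, ⟨?_, fun X' _ => ?_⟩, ?_⟩
  · rw [hAW]
    exact smul_ne_zero (by exact_mod_cast ht0.ne') hp0
  · exact nuclearNorm_descent_le hu hx j (by linarith) ht0.le le_rfl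
  · rw [measurement_add, measurement_smul, sub_self, norm_zero]
    exact norm_nonneg _
  · rw [add_sub_cancel_left, norm_smul, norm_smul, htn]
    have hbν : b ≤ 33 / 8 * (ν * Real.sqrt (L / n)) := by
      rw [hb, Real.sqrt_le_left (by positivity), mul_pow, mul_pow, Real.sq_sqrt (by positivity)]
      have : 0 ≤ ν ^ 2 * (L / n) := by positivity
      rw [mul_div_assoc, mul_div_assoc]
      linarith
    have h1 : ‖measurement D W‖ ≤ β * K := by rw [hAW]; exact hpK
    have h2 : β * K ≤ 50 / 8 * (ν * Real.sqrt (L / n)) * K := by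
      gcongr
      have : 0 ≤ ν * Real.sqrt (L / n) := by positivity
      linarith
    calc t * ‖measurement D W‖ ≤ t * (50 / 8 * (ν * Real.sqrt (L / n)) * K) := by
          gcongr; exact h1.trans h2
      _ = 50 * ν * Real.sqrt (L / n) * K * (t * (1 / 8)) := by ring
      _ ≤ _ := by gcongr

end Instability

/-! ### Truncation of almost surely bounded masks -/

section Truncation

/-- Independent copies of a mask variable agree almost surely with a family of measurable masks
that are bounded everywhere. -/
lemma exists_isMaskFamily_ae_eq {Ω₀ Ω ι : Type*} [MeasurableSpace Ω₀] {P₀ : Measure Ω₀}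
    {g : Ω₀ → ℂ} [MeasurableSpace Ω] {P : Measure Ω} {ν : ℝ} (hν : 0 ≤ ν) {d : ι → Ω → ℂ}
    (hg : IsMaskVariable P₀ g ν) (hd : ∀ i, IdentDistrib (d i) g P P₀) (hind : iIndepFun d P) :
    ∃ ξ : ι → Ω → ℂ, IsMaskFamily P ξ ν ∧ ∀ i, d i =ᵐ[P] ξ i := by
  have hm : ∀ i, AEMeasurable (d i) P := fun i => (hd i).aemeasurable_fst
  have hball : MeasurableSet {z : ℂ | ‖z‖ ≤ ν} := measurableSet_le measurable_norm measurable_const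
  have hbound : ∀ i, ∀ᵐ ω ∂P, ‖d i ω‖ ≤ ν := fun i => (hd i).symm.ae_snd hball hg.norm_le
  let τ : ℂ → ℂ := Set.indicator {z : ℂ | ‖z‖ ≤ ν} id
  have hτ : Measurable τ := measurable_id.indicator hball
  have hae : ∀ i, d i =ᵐ[P] fun ω => τ ((hm i).mk (d i) ω) := fun i => by
    filter_upwards [(hm i).ae_eq_mk, hbound i] with ω h1 h2
    rw [← h1]
    exact (Set.indicator_of_mem (s := {z : ℂ | ‖z‖ ≤ ν}) h2 id).symm
  refine ⟨fun i ω => τ ((hm i).mk (d i) ω), ⟨hind.congr hae, fun i =>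
    hτ.comp (hm i).measurable_mk, fun i ω => ?_, fun i => ?_, fun i => ?_⟩, hae⟩
  · by_cases h : ‖(hm i).mk (d i) ω‖ ≤ ν
    · have : τ ((hm i).mk (d i) ω) = (hm i).mk (d i) ω :=
        Set.indicator_of_mem (s := {z : ℂ | ‖z‖ ≤ ν}) h id
      rwa [this]
    · have : τ ((hm i).mk (d i) ω) = 0 :=
        Set.indicator_of_notMem (s := {z : ℂ | ‖z‖ ≤ ν}) h id
      rwa [this, norm_zero]
  · rw [← integral_congr_ae (hae i), (hd i).integral_eq, hg.mean_zero]
  · have h1 : (fun ω => ‖d i ω‖ ^ 2) =ᵐ[P] fun ω => ‖τ ((hm i).mk (d i) ω)‖ ^ 2 := by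
      filter_upwards [hae i] with ω hω
      rw [hω]
    rw [← integral_congr_ae h1, ← hg.second_moment]
    exact ((hd i).comp (u := fun z : ℂ => ‖z‖ ^ 2) (by fun_prop)).integral_eq

end Truncation

/-! ### Sizes of the parameters -/

section Parameters

lemma one_le_coherence_and_le {n : ℕ} {h : EuclideanSpace ℂ (Fin n)} (hh : ‖dft h‖ = 1) :
    1 ≤ coherence h ∧ coherence h ≤ n := by
  have h1 := norm_dft_sq h
  rw [hh, one_pow] at h1
  have hn : (0 : ℝ) < n := by
    rcases (Nat.cast_nonneg n : (0 : ℝ) ≤ n).eq_or_lt with h0 | h0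
    · rw [← h0] at h1; simp at h1
    · exact h0
  have hnorm : ‖h‖ ^ 2 = 1 / n := by rw [eq_div_iff hn.ne']; linarith
  have hc : coherence h = n * ‖(dft h).ofLp‖ ^ 2 := by
    rw [coherence, hnorm]; field_simp
  rw [hc]
  constructor
  · calc (1 : ℝ) = ‖dft h‖ ^ 2 := by rw [hh, one_pow]
      _ = ∑ j, ‖dft h j‖ ^ 2 := EuclideanSpace.norm_sq_eq _
      _ ≤ ∑ _j : Fin n, ‖(dft h).ofLp‖ ^ 2 := Finset.sum_le_sum fun j _ =>
          pow_le_pow_left₀ (norm_nonneg _) (norm_le_pi_norm _ j) 2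
      _ = n * ‖(dft h).ofLp‖ ^ 2 := by simp
  · have : ‖(dft h).ofLp‖ ≤ 1 := by
      rw [pi_norm_le_iff_of_nonneg zero_le_one, ← hh]
      exact fun j => PiLp.norm_apply_le (dft h) j
    have := pow_le_pow_left₀ (norm_nonneg _) this 2
    nlinarith

/-- The upper bound on `L ≥ 1` forces `log (log n) > 0`; for smaller `n` its right-hand side is at
most zero, as `log (n / μ) ≥ 0`. -/
lemma one_lt_log_and_le {n L : ℕ} {c μ : ℝ} (hc : 0 < c) (hL : 1 ≤ L) (hμ : 1 ≤ μ) (hμn : μ ≤ n)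
    (h : (L : ℝ) ≤ c * (μ * Real.log n ^ 2 * Real.log (n / μ) * Real.log (Real.log n))) :
    1 < Real.log n ∧ (L : ℝ) ≤ c * (μ * Real.log n ^ 4) := by
  have hL' : (1 : ℝ) ≤ L := by exact_mod_cast hL
  have hn : (1 : ℝ) ≤ n := hμ.trans hμn
  have hl : 0 ≤ Real.log n := Real.log_nonneg hn
  have h1 : 0 ≤ Real.log (n / μ) := Real.log_nonneg (by rw [le_div_iff₀ (by linarith)]; linarith)
  have h2 : Real.log (n / μ) ≤ Real.log n :=
    Real.log_le_log (div_pos (by linarith) (by linarith)) (div_le_self (by linarith) hμ)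
  have hlog : 1 < Real.log n := by
    by_contra! hle
    have : Real.log (Real.log n) ≤ 0 := Real.log_nonpos hl hle
    have h3 : 0 ≤ μ * Real.log n ^ 2 * Real.log (n / μ) := by positivity
    have := mul_nonpos_of_nonneg_of_nonpos hc.le (mul_nonpos_of_nonneg_of_nonpos h3 this)
    linarith
  refine ⟨hlog, h.trans ?_⟩
  have h4 : Real.log (Real.log n) ≤ Real.log n := Real.log_le_self hl
  have h5 : 0 ≤ Real.log (Real.log n) := Real.log_nonneg hlog.le
  calc c * (μ * Real.log n ^ 2 * Real.log (n / μ) * Real.log (Real.log n))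
      ≤ c * (μ * Real.log n ^ 2 * Real.log n * Real.log n) := by gcongr
    _ = _ := by ring

/-- Bootstrapping `y ≥ 32 log y` through powers of two, from `log y ≥ 1`. -/
lemma five_le_log {y : ℝ} (h1 : 1 ≤ Real.log y) (h : 32 * Real.log y ≤ y) : 5 ≤ Real.log y := by
  have hy : 0 < y := by linarith
  have pow2 : ∀ k : ℕ, (2 : ℝ) ^ k ≤ y → k * 0.6931471803 ≤ Real.log y := fun k hk => by
    have := Real.log_le_log (by positivity) hk
    rw [Real.log_pow] at this
    have h2 : (0.6931471803 : ℝ) ≤ Real.log 2 := Real.log_two_gt_d9.le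
    have : (k : ℝ) * 0.6931471803 ≤ k * Real.log 2 := by gcongr
    linarith
  have h5 := pow2 5 (by norm_num; linarith)
  have h6 := pow2 6 (by norm_num at h5 ⊢; linarith)
  have h7 := pow2 7 (by norm_num at h6 ⊢; linarith)
  have hy2 : 149 ≤ y := by norm_num at h7; linarith
  rw [Real.le_log_iff_exp_le hy]
  have he : Real.exp 5 = Real.exp 1 ^ 5 := by rw [← Real.exp_nat_mul]; norm_num
  rw [he]
  refine (pow_le_pow_left₀ (Real.exp_pos _).le Real.exp_one_lt_d9.le 5).trans ?_
  refine le_trans ?_ hy2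
  norm_num

/-- The bound `L ≤ c μ ℓ ^ 4` leaves a factor `√ℓ` to spare. -/
lemma sqrt_mul_sqrt_div_mul_sqrt_log_le {n L c μ ℓ : ℝ} (hc : 0 ≤ c) (hn : 0 < n)
    (hμ : 0 < μ) (hℓ : 1 ≤ ℓ) (hL : L ≤ c * (μ * ℓ ^ 4)) :
    Real.sqrt n * (Real.sqrt (L / n) * Real.sqrt (12 * ℓ))
      ≤ 4 * (Real.sqrt c * Real.sqrt μ * ℓ ^ 3) := by
  have hℓ0 : 0 ≤ ℓ := by linarith
  rw [← Real.sqrt_mul' _ (by positivity), ← Real.sqrt_mul hn.le,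
    Real.sqrt_le_left (by positivity), mul_pow, mul_pow, mul_pow, Real.sq_sqrt hc,
    Real.sq_sqrt hμ.le]
  have e1 : n * (L / n * (12 * ℓ)) = 12 * (L * ℓ) := by field_simp
  rw [e1]
  have e2 : L * ℓ ≤ c * (μ * ℓ ^ 4) * ℓ := by gcongr
  have e3 : c * (μ * ℓ ^ 4) * ℓ ≤ c * (μ * ℓ ^ 4) * ℓ ^ 2 := by
    gcongr
    nlinarith
  have e4 : 0 ≤ c * (μ * ℓ ^ 4) * ℓ ^ 2 := by positivity
  nlinarith

end Parameters

end BlindDeconv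

theorem theorem2 (ν : ℝ) (hν : 1 ≤ ν) (Cν : ℝ) (hCν : 0 < Cν)
    (c₁ c₂ : ℝ) (hc₁ : 0 < c₁) (hc₂ : 0 < c₂) :
    ∃ Ctilde : ℝ, 0 < Ctilde ∧
      ∀ {Ω₀ : Type*} [MeasurableSpace Ω₀] (P₀ : Measure Ω₀) [IsProbabilityMeasure P₀] (g : Ω₀ → ℂ)
        {Ω : Type*} [MeasurableSpace Ω] (P : Measure Ω) [IsProbabilityMeasure P]
        (n L : ℕ) (d : Fin n → Fin L → Ω → ℂ),
      BlindDeconv.IsMaskVariable P₀ g ν →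
      (∀ j l, IdentDistrib (d j l) g P P₀) →
      iIndepFun (fun p : Fin n × Fin L => d p.1 p.2) P →
      1 ≤ L →
      32 * ν ^ 6 * L * Real.log n ≤ n →
      ∀ᵐ x : Metric.sphere (0 : EuclideanSpace ℂ (Fin n)) 1
          ∂((volume : Measure (EuclideanSpace ℂ (Fin n))).toSphere),
      ∀ h : EuclideanSpace ℂ (Fin n), ‖BlindDeconv.dft h‖ = 1 →
      c₁ * (Cν * BlindDeconv.coherence h * Real.log n ^ 2
          * Real.log (n / BlindDeconv.coherence h) * Real.log (Real.log n)) ≤ L →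
      L ≤ c₂ * (Cν * BlindDeconv.coherence h * Real.log n ^ 2
          * Real.log (n / BlindDeconv.coherence h) * Real.log (Real.log n)) →
      ∃ E : Set Ω, MeasurableSet E ∧ 1 - 4 / (n : ℝ) ≤ P.real E ∧
        ∀ ω ∈ E, ∃ (Z : Matrix (Fin n) (Fin L) ℂ) (X : Matrix (Fin n) (Fin n) ℂ),
          Z ≠ 0 ∧
          BlindDeconv.IsConstrainedLSSolution (Matrix.of fun j l => d j l ω)
            (BlindDeconv.measurement (Matrix.of fun j l => d j l ω)
              (BlindDeconv.outer (BlindDeconv.dft h) x) + Z)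
            (BlindDeconv.nuclearNorm (BlindDeconv.outer (BlindDeconv.dft h) x)) X ∧
          Real.sqrt n
              / (Ctilde * Real.sqrt (BlindDeconv.coherence h) * Real.log n ^ 3) * ‖Z‖
            ≤ ‖X - BlindDeconv.outer (BlindDeconv.dft h) x‖ := by
  have hν0 : 0 < ν := by linarith
  refine ⟨200 * ν ^ 2 * Real.sqrt (c₂ * Cν), by positivity, ?_⟩
  intro Ω₀ _ P₀ _ g Ω _ P _ n L d hg hd hind hL hn
  refine Filter.Eventually.of_forall fun x h hh _ hLub => ?_
  have hx : ‖(x : EuclideanSpace ℂ (Fin n))‖ = 1 := by simp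
  obtain ⟨hμ, hμn⟩ := BlindDeconv.one_le_coherence_and_le hh
  set μ := BlindDeconv.coherence h
  obtain ⟨hlog, hLμ⟩ := BlindDeconv.one_lt_log_and_le (c := c₂ * Cν) (by positivity) hL hμ hμn
    (hLub.trans (le_of_eq (by ring)))
  set ℓ := Real.log n with hℓ
  have hL' : (1 : ℝ) ≤ L := by exact_mod_cast hL
  have hn0 : (0 : ℝ) < n := by linarith
  have hν6 : ν ^ 2 ≤ ν ^ 6 := pow_le_pow_right₀ hν (by norm_num)
  have hνν : ν ≤ ν ^ 2 := by nlinarith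
  have hn2 : 32 * (ν ^ 2 * L) * ℓ ≤ n := by
    refine le_trans ?_ hn
    have : 0 ≤ (ν ^ 6 - ν ^ 2) * (L * ℓ) :=
      mul_nonneg (by linarith) (mul_nonneg (by linarith) (by linarith))
    nlinarith
  have hνL : 1 ≤ ν ^ 2 * L := by nlinarith
  have hℓ5 : 5 ≤ ℓ := BlindDeconv.five_le_log hlog.le (le_trans (by nlinarith) hn2)
  have hn160 : 160 * (ν ^ 2 * L) ≤ n := le_trans (by nlinarith) hn2
  have hn160' : 160 * (ν * L) ≤ n := le_trans (by nlinarith) hn160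
  have h4L : 4 * L ≤ n := by
    have : (4 * L : ℝ) ≤ n := by nlinarith
    exact_mod_cast this
  have hn1 : 1 ≤ n := by exact_mod_cast hn0
  obtain ⟨ξ, hξ, hae⟩ := BlindDeconv.exists_isMaskFamily_ae_eq hν0.le hg
    (fun p : Fin n × Fin L => hd p.1 p.2) hind
  set K := ν * Real.sqrt (12 * ℓ) with hK
  have hK0 : 0 < K := mul_pos hν0 (Real.sqrt_pos.2 (by linarith))
  let a : Fin n → Fin n → ℂ := fun j k => BlindDeconv.dftMatrix n j k * x.1 k
  have ha : ∀ j, ∑ k, ‖a j k‖ ^ 2 = 1 := fun j => by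
    simp only [a, norm_mul, BlindDeconv.norm_dftMatrix, one_mul]
    rw [← EuclideanSpace.norm_sq_eq, hx, one_pow]
  -- The three exceptional events: an ill-conditioned mask matrix, a large transformed
  -- measurement of `x`, and the null event on which the masks differ from the truncated ones.
  set B₁ := {ω | ∃ z : EuclideanSpace ℂ (Fin L),
    ‖Matrix.toEuclideanLin (Matrix.of fun k l => ξ (k, l) ω) z‖ < Real.sqrt n / 4 * ‖z‖}
  set B₂ := {ω | ∃ j l, K < ‖∑ k, a j k * ξ (k, l) ω‖}
  set B₃ := {ω | ¬ ∀ p : Fin n × Fin L, d p.1 p.2 ω = ξ p ω}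
  have hB₁ : P.real B₁ ≤ 1 / n := hξ.measureReal_exists_norm_lt_le hν hL hn160'
    (le_trans (le_of_eq (by ring)) hn2)
  have hB₂ : P.real B₂ ≤ 1 / n := hξ.measureReal_exists_lt_norm_sum_le hν h4L hn1 a ha
  have hB₃ : P.real B₃ = 0 := by
    rw [measureReal_eq_zero_iff]
    exact ae_iff.1 (ae_all_iff.2 hae)
  have hB : P.real (B₁ ∪ B₂ ∪ B₃) ≤ 2 / n := by
    have h1 := measureReal_union_le (μ := P) B₁ B₂
    have h2 := measureReal_union_le (μ := P) (B₁ ∪ B₂) B₃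
    have h3 : (2 : ℝ) / n = 1 / n + 1 / n := by ring
    linarith
  refine ⟨(toMeasurable P (B₁ ∪ B₂ ∪ B₃))ᶜ, (measurableSet_toMeasurable _ _).compl, ?_, ?_⟩
  · rw [probReal_compl_eq_one_sub (measurableSet_toMeasurable _ _), measureReal_def,
      measure_toMeasurable, ← measureReal_def]
    have h3 : (2 : ℝ) / n ≤ 4 / n := by gcongr; norm_num
    linarith
  intro ω hω
  have hω' : ω ∉ B₁ ∪ B₂ ∪ B₃ := fun hmem => hω (subset_toMeasurable _ _ hmem)
  simp only [Set.mem_union, not_or] at hω'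
  obtain ⟨⟨hω₁, hω₂⟩, hω₃⟩ := hω'
  have hdξ : ∀ j l, d j l ω = ξ (j, l) ω := fun j l => not_not.1 hω₃ (j, l)
  have hD : (Matrix.of fun j l => d j l ω) = Matrix.of fun j l => ξ (j, l) ω := by
    ext j l
    exact hdξ j l
  rw [hD]
  obtain ⟨Z, X, hZ, hX, hZX⟩ := BlindDeconv.exists_noise_solution hν hL hn160
    (D := Matrix.of fun j l => ξ (j, l) ω) (fun j l => hξ.norm_le (j, l) ω)
    (fun z => not_lt.1 fun hlt => hω₁ ⟨z, hlt⟩) hh hx hK0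
    (fun j l => not_lt.1 fun hlt => hω₂ ⟨j, l, hlt⟩)
  refine ⟨Z, X, hZ, hX, ?_⟩
  have hμ0 : 0 < μ := by linarith
  have hℓ0 : 0 < ℓ := by linarith
  have hden : 0 < 200 * ν ^ 2 * Real.sqrt (c₂ * Cν) * Real.sqrt μ * ℓ ^ 3 := by positivity
  rw [div_mul_eq_mul_div, div_le_iff₀ hden]
  refine (mul_le_mul_of_nonneg_left hZX (Real.sqrt_nonneg _)).trans ?_
  have hkey := BlindDeconv.sqrt_mul_sqrt_div_mul_sqrt_log_le (c := c₂ * Cν) (by positivity) hn0 hμ0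
    hlog.le hLμ
  set w := ‖X - BlindDeconv.outer (BlindDeconv.dft h) x‖
  have hw : 0 ≤ w := norm_nonneg _
  calc Real.sqrt n * (50 * ν * Real.sqrt (L / n) * K * w)
      = 50 * ν ^ 2 * (Real.sqrt n * (Real.sqrt (L / n) * Real.sqrt (12 * ℓ))) * w := by
        rw [hK]; ring
    _ ≤ 50 * ν ^ 2 * (4 * (Real.sqrt (c₂ * Cν) * Real.sqrt μ * ℓ ^ 3)) * w := by gcongr
    _ = w * (200 * ν ^ 2 * Real.sqrt (c₂ * Cν) * Real.sqrt μ * ℓ ^ 3) := by ring
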